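/- **Setting.** Let $\mathbb{R}^p=\prod_{j=1}^n\mathbb{R}^{p_j}$ and $\mathbb{R}^d=\prod_{i=1}^m\mathbb{R}^{d_i}$ carry the Euclidean norm, let $f(x)=\sum_{j=1}^n f_j(x_j)$ and $g(y)=\sum_{i=1}^m g_i(y_i)$ with all $f_j:\mathbb{R}^{p_j}\to\mathbb{R}\cup\{+\infty\}$ and $g_i:\mathbb{R}^{d_i}\to\mathbb{R}\cup\{+\infty\}$ proper, closed and convex, let $h:\mathbb{R}^p\to\mathbb{R}$ be convex and differentiable, and let $K\in\mathbb{R}^{d\times p}$. Suppose that for every block $j$ there is $L_j^h\ge 0$ with $\|\nabla_{x_j}h(x+U_jv)-\nabla_{x_j}h(x)\|\le L_j^h\|v\|$ for all $x\in\mathbb{R}^p$, $v\in\mathbb{R}^{p_j}$, where $U_jv$ is the vector with $j$-th block $v$ and zeros elsewhere. Put $\phi=f+h$, and consider $$F^\star=\min_x\{F(x)=\phi(x)+g(Kx)\},\qquad G^\star=\min_y\{G(y)=\phi^*(-K^\top y)+g^*(y)\}.$$ Assume that the primal problem has a solution, that $0\in\mathrm{ri}(\mathrm{dom}\,g-K\,\mathrm{dom}\,\phi)$,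 and that $g$ is finite and $M_g$-Lipschitz continuous on $\mathbb{R}^d$. **Parameters.** Let $q\in\mathbb{R}^n_{++}$ and $\hat q\in\mathbb{R}^m_{++}$ be probability vectors, $\sigma\in\mathbb{R}^n_{++}$, $\rho_0>0$, $\tau_0=\min\{\min_i\hat q_i,\min_jq_j\}$, $\bar L_\sigma=\|K\,\mathrm{diag}(1/\sqrt\sigma)\|^2$ (spectral norm; the $j$-th block is scaled by $1/\sqrt{\sigma_j}$), $L^h_\sigma=\max_jL^h_j/\sigma_j$, and assume that $L^h_\sigma$ and $\bar L_\sigma$ are not both $0$. Let $c>1$ with $c\tau_0>1$, and for $k\ge 0$ set $$\tau_k=\frac{c\tau_0}{k+c},\quad \rho_k=\frac{\rho_0\tau_0}{\tau_k},\quad \gamma_k=\frac1{4\rho_k},\quad \beta_k=\frac{1}{L^h_\sigma+4\bar L_\sigma\rho_k},\quad \eta_k=\frac{\rho_k}{2}.$$ **Algorithm 1.** Start from $\hat y^0\in\mathbb{R}^d$ and $x^0\in\mathbb{R}^p$ with $F(x^0)<+\infty$, and put $\tilde x^0=x^0$, $\tilde r^0=r^0=Kx^0$. For $k=0,1,2,\dots$,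 put $\hat r^k=(1-\tau_k)r^k+\tau_k\tilde r^k$ and $\hat x^k=(1-\tau_k)x^k+\tau_k\tilde x^k$; draw indices $i_k\in[m]$ and $j_k\in[n]$, independent of each other and of all earlier draws, with $\mathbb{P}(i_k=i)=\hat q_i$ and $\mathbb{P}(j_k=j)=q_j$; with $\hat\Delta_r^k=-\hat y^k+\rho_k(\hat r^k-K\hat x^k)$ and $\hat\Delta_x^k=\nabla h(\hat x^k)+K^\top(\hat y^k+\rho_k(K\hat x^k-\hat r^k))$, update only the blocks $$\tilde r^{k+1}_{i}=\mathrm{prox}_{\tau_0\gamma_kg_i/\tau_k}\Big(\tilde r^k_i-\tfrac{\tau_0\gamma_k}{\tau_k}\hat\Delta^k_{r_i}\Big)\ (i=i_k),\qquad \tilde x^{k+1}_{j}=\mathrm{prox}_{\tau_0\beta_kf_j/(\tau_k\sigma_j)}\Big(\tilde x^k_j-\tfrac{\tau_0\beta_k}{\tau_k\sigma_j}\hat\Delta^k_{x_j}\Big)\ (j=j_k),$$ keeping all other blocks of $\tilde r^k$ and $\tilde x^k$; finally put $r^{k+1}=\hat r^k+\frac{\tau_k}{\tau_0}(\tilde r^{k+1}-\tilde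 r^k)$, $x^{k+1}=\hat x^k+\frac{\tau_k}{\tau_0}(\tilde x^{k+1}-\tilde x^k)$ and $\hat y^{k+1}=\hat y^k+\eta_k[Kx^{k+1}-r^{k+1}-(1-\tau_k)(Kx^k-r^k)]$. **Theorem 3.2.** For every $k\ge 0$, $F(x^k)$ is almost surely finite and integrable, and for every primal solution $x^\star$ and every dual solution $y^\star$, $$\mathbb{E}[F(x^k)-F^\star]\le\frac{c\,\mathcal{E}_0^2+(M_g+\|y^\star\|)\,\mathcal{E}_0\,c\sqrt{2c/\rho_0}}{k+c-1},$$ where $\mathcal E_0\ge 0$ and $$\mathcal{E}_0^2=F(x^0)-F^\star+\frac1{\rho_0}\|\hat y^0-y^\star\|^2+\frac{(L^h_\sigma+4\rho_0\bar L_\sigma)\tau_0}{2}\sum_{j=1}^n\frac{\sigma_j}{q_j}\|x^0_j-x^\star_j\|^2+2\tau_0\rho_0\sum_{i=1}^m\frac{1}{\hat q_i}\|(K(x^0-x^\star))_i\|^2.$$ Simultaneously, $$\liminf_{k\to\infty}\ k\sqrt{\log k}\cdot\mathbb{E}[F(x^k)-F^\star]=0,$$ that is, $\mathbb{E}[F(x^k)]-F^\star=\underline{o}\big(1/(k\sqrt{\log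 k})\big)$, where $u_k=\underline{o}(v_k)$ means $\liminf_{k\to\infty}u_k/v_k=0$. -/

import Mathlib

open MeasureTheory ProbabilityTheory Filter
open scoped NNReal ENNReal RealInnerProductSpace Pointwise Gradient

noncomputable section

namespace RandomizedPD

/-! ### Extended-valued convex functions -/

section Convex

variable {E : Type*} [NormedAddCommGroup E] [InnerProductSpace ℝ E]

/-- Effective domain of an extended-valued function. -/
def effDom (f : E → EReal) : Set E := {x | f x < ⊤}

/-- Proper, closed (lower semicontinuous) and convex functions `E → ℝ ∪ {+∞}`. -/
structure ProperClosedConvex (f : E → EReal) : Prop where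
  ne_bot : ∀ x, f x ≠ ⊥
  dom_nonempty : (effDom f).Nonempty
  closed : LowerSemicontinuous f
  convex : ∀ x y : E, ∀ a b : ℝ, 0 ≤ a → 0 ≤ b → a + b = 1 →
    f (a • x + b • y) ≤ (a : EReal) * f x + (b : EReal) * f y

/-- Fenchel conjugate `f^*(z) = sup_x (⟨z, x⟩ - f x)`. -/
def conjugate (f : E → EReal) (z : E) : EReal := ⨆ x, ((⟪z, x⟫ : ℝ) : EReal) - f x

/-- `u` minimizes `v ↦ f v + (1/2) ‖v - x‖²`. -/
def IsProx (f : E → EReal) (x u : E) : Prop :=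
  ∀ v, f u + ((1 / 2 * ‖u - x‖ ^ 2 : ℝ) : EReal) ≤ f v + ((1 / 2 * ‖v - x‖ ^ 2 : ℝ) : EReal)

/-- The proximal operator; for proper closed convex `f` on a finite-dimensional space the
minimizer exists and is unique. -/
def prox (f : E → EReal) (x : E) : E := Classical.epsilon (IsProx f x)

/-- `M`-Lipschitz continuity of an extended-valued function on the whole space; for a proper
function it forces all values to be finite. -/
def LipschitzExt (M : ℝ≥0) (f : E → EReal) : Prop :=
  ∀ x y, f x ≤ f y + ((M * ‖x - y‖ : ℝ) : EReal)

end Convex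

/-! ### Block spaces -/

/-- `ℝ^{p_1 + ... + p_n}` with its block structure and its Euclidean norm. -/
abbrev BlockSpace {n : ℕ} (p : Fin n → ℕ) : Type :=
  PiLp 2 (fun j : Fin n => EuclideanSpace ℝ (Fin (p j)))

/-- Squared weighted norm `∑_j w_j ‖x_j‖²`. -/
def wNormSq {n : ℕ} {p : Fin n → ℕ} (w : Fin n → ℝ) (x : BlockSpace p) : ℝ :=
  ∑ j, w j * ‖x j‖ ^ 2

/-- The block-diagonal operator `x ↦ (w_j x_j)_j`. -/
def blockDiag {n : ℕ} (p : Fin n → ℕ) (w : Fin n → ℝ) : BlockSpace p →L[ℝ] BlockSpace p :=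
  LinearMap.toContinuousLinearMap
    { toFun := fun x => WithLp.toLp 2 (fun j => w j • x j)
      map_add' := fun x y => by ext j; simp
      map_smul' := fun a x => by ext j; simp [mul_left_comm] }

/-- Replace the `j`-th block of `x` by `u`. -/
def setBlock {n : ℕ} {p : Fin n → ℕ} (x : BlockSpace p) (j : Fin n)
    (u : EuclideanSpace ℝ (Fin (p j))) : BlockSpace p :=
  WithLp.toLp 2 (Function.update (fun l => x l) j u)

/-! ### The primal and dual problems -/

/-- Data of `min_x f(x) + h(x) + g(Kx)` with `f(x) = ∑_j f_j(x_j)`, `g(y) = ∑_i g_i(y_i)`. -/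
structure Problem (n m : ℕ) where
  p : Fin n → ℕ
  d : Fin m → ℕ
  f : (j : Fin n) → EuclideanSpace ℝ (Fin (p j)) → EReal
  g : (i : Fin m) → EuclideanSpace ℝ (Fin (d i)) → EReal
  h : BlockSpace p → ℝ
  K : BlockSpace p →L[ℝ] BlockSpace d

namespace Problem

variable {n m : ℕ} (P : Problem n m)

def fSum (x : BlockSpace P.p) : EReal := ∑ j, P.f j (x j)

def gSum (y : BlockSpace P.d) : EReal := ∑ i, P.g i (y i)

def phi (x : BlockSpace P.p) : EReal := P.fSum x + (P.h x : EReal)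

/-- Primal objective. -/
def F (x : BlockSpace P.p) : EReal := P.phi x + P.gSum (P.K x)

/-- Primal optimal value. -/
def Fstar : EReal := ⨅ x, P.F x

/-- Transpose of `K`. -/
def KT : BlockSpace P.d →L[ℝ] BlockSpace P.p := ContinuousLinearMap.adjoint P.K

/-- Dual objective (to be minimized). -/
def G (y : BlockSpace P.d) : EReal := conjugate P.phi (-(P.KT y)) + conjugate P.gSum y

def primalSolutions : Set (BlockSpace P.p) := {x | ∀ z, P.F x ≤ P.F z}

def dualSolutions : Set (BlockSpace P.d) := {y | ∀ z, P.G y ≤ P.G z}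

/-- The standing assumption; `L j` is the partial smoothness constant of `h` in block `j`. -/
structure Assumption (L : Fin n → ℝ) : Prop where
  f_pcc : ∀ j, ProperClosedConvex (P.f j)
  g_pcc : ∀ i, ProperClosedConvex (P.g i)
  h_convex : ConvexOn ℝ Set.univ P.h
  h_diff : Differentiable ℝ P.h
  L_nonneg : ∀ j, 0 ≤ L j
  h_smooth : ∀ (x : BlockSpace P.p) (j : Fin n) (v : EuclideanSpace ℝ (Fin (P.p j))),
    ‖(∇ P.h (x + PiLp.single 2 j v)) j - (∇ P.h x) j‖ ≤ L j * ‖v‖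
  solution : P.primalSolutions.Nonempty
  slater : (0 : BlockSpace P.d) ∈
    intrinsicInterior ℝ (effDom P.gSum - P.K '' effDom P.phi)

end Problem

/-! ### Parameters -/

/-- User-chosen parameters: weights `σ`, sampling distributions `q` on `[n]` and `qh` on `[m]`,
smoothness constants `L` of `h`, and the scalars `c` and `ρ₀`. -/
structure Params (n m : ℕ) where
  σ : Fin n → ℝ
  q : Fin n → ℝ
  qh : Fin m → ℝ
  L : Fin n → ℝ
  c : ℝ
  ρ₀ : ℝ

namespace Params

variable {n m : ℕ} (S : Params n m)

/-- `τ₀ = min {min_i qh_i, min_j q_j}`. -/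
def τ₀ : ℝ := min (⨅ i, S.qh i) (⨅ j, S.q j)

/-- `L^h_σ = max_j L_j / σ_j`. -/
def Lhσ : ℝ := ⨆ j, S.L j / S.σ j

/-- `‖K diag(1/√σ)‖²`, with the spectral norm. -/
def Lbar (P : Problem n m) : ℝ := ‖P.K ∘L blockDiag P.p (fun j => 1 / √(S.σ j))‖ ^ 2

def τ (k : ℕ) : ℝ := S.c * S.τ₀ / (k + S.c)

def ρ (k : ℕ) : ℝ := S.ρ₀ * S.τ₀ / S.τ k

def γ (k : ℕ) : ℝ := 1 / (4 * S.ρ k)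

def β (P : Problem n m) (k : ℕ) : ℝ := 1 / (S.Lhσ + 4 * S.Lbar P * S.ρ k)

def η (k : ℕ) : ℝ := S.ρ k / 2

/-- Positivity of the parameters, `q` and `qh` are probability vectors, and `c > 1`. -/
structure Admissible : Prop where
  σ_pos : ∀ j, 0 < S.σ j
  q_pos : ∀ j, 0 < S.q j
  qh_pos : ∀ i, 0 < S.qh i
  q_sum : ∑ j, S.q j = 1
  qh_sum : ∑ i, S.qh i = 1
  ρ₀_pos : 0 < S.ρ₀
  one_lt_c : 1 < S.c

end Params

/-! ### The fully randomized primal-dual algorithm -/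

/-- The variables `(x^k, x̃^k, r^k, r̃^k, ŷ^k, ȳ^k)`. -/
structure State {n m : ℕ} (P : Problem n m) where
  x : BlockSpace P.p
  xt : BlockSpace P.p
  r : BlockSpace P.d
  rt : BlockSpace P.d
  yh : BlockSpace P.d
  yb : BlockSpace P.d

section Algorithm

variable {n m : ℕ} (P : Problem n m) (S : Params n m)

/-- Initial state from `(x⁰, ŷ⁰)`. -/
def initState (x0 : BlockSpace P.p) (y0 : BlockSpace P.d) : State P where
  x := x0
  xt := x0
  r := P.K x0
  rt := P.K x0
  yh := y0
  yb := y0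

/-- One iteration with counter `k` and sampled indices `i = i_k`, `j = j_k`. -/
def step (k : ℕ) (i : Fin m) (j : Fin n) (s : State P) : State P :=
  let τ := S.τ k
  let rh := (1 - τ) • s.r + τ • s.rt
  let xh := (1 - τ) • s.x + τ • s.xt
  let Δr := -s.yh + S.ρ k • (rh - P.K xh)
  let Δx := ∇ P.h xh + P.KT (s.yh + S.ρ k • (P.K xh - rh))
  let a := S.τ₀ * S.γ k / τ
  let b := S.τ₀ * S.β P k / (τ * S.σ j)
  let rt' := setBlock s.rt i (prox (fun u => (a : EReal) * P.g i u) (s.rt i - a • Δr i))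
  let xt' := setBlock s.xt j (prox (fun u => (b : EReal) * P.f j u) (s.xt j - b • Δx j))
  let r' := rh + (τ / S.τ₀) • (rt' - s.rt)
  let x' := xh + (τ / S.τ₀) • (xt' - s.xt)
  { x := x'
    xt := xt'
    r := r'
    rt := rt'
    yh := s.yh + S.η k • (P.K x' - r' - (1 - τ) • (P.K s.x - s.r))
    yb := (1 - τ) • s.yb + τ • (s.yh + S.ρ k • (P.K xh - rh)) }

/-- The iterates, driven by the index sequences `i_0, i_1, …` and `j_0, j_1, …`. -/
def iterate (x0 : BlockSpace P.p) (y0 : BlockSpace P.d) (is : ℕ → Fin m) (js : ℕ → Fin n) :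
    ℕ → State P
  | 0 => initState P x0 y0
  | k + 1 => step P S k (is k) (js k) (iterate x0 y0 is js k)

/-- The constant `E₀²`, for a primal solution `xs` and a dual solution `ys`. -/
def E0sq (x0 : BlockSpace P.p) (y0 : BlockSpace P.d)
    (xs : BlockSpace P.p) (ys : BlockSpace P.d) : ℝ :=
  (P.F x0 - P.Fstar).toReal + 1 / S.ρ₀ * ‖y0 - ys‖ ^ 2
    + (S.Lhσ + 4 * S.ρ₀ * S.Lbar P) * S.τ₀ / 2 * wNormSq (fun j => S.σ j / S.q j) (x0 - xs)
    + 2 * S.τ₀ * S.ρ₀ * wNormSq (fun i => 1 / S.qh i) (P.K (x0 - xs))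

end Algorithm

/-- The random indices: at every iteration `i_k` has law `qh`, `j_k` has law `q`, they are
independent of each other, and the pairs `(i_k, j_k)` are independent over `k`. -/
structure Sampling {n m : ℕ} (S : Params n m) {Ω : Type*} [MeasurableSpace Ω] (μ : Measure Ω)
    (is : ℕ → Ω → Fin m) (js : ℕ → Ω → Fin n) : Prop where
  meas_i : ∀ k, Measurable (is k)
  meas_j : ∀ k, Measurable (js k)
  law_i : ∀ k i, μ.real {ω | is k ω = i} = S.qh i
  law_j : ∀ k j, μ.real {ω | js k ω = j} = S.q j
  indep_ij : ∀ k, IndepFun (is k) (js k) μ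
  indep_iter : iIndepFun (fun k ω => (is k ω, js k ω)) μ

/-- `u_k = o(v_k)` in the liminf sense: `liminf_k u_k / v_k = 0`. The liminf is taken in the
extended reals, so that it has no default value for unbounded sequences. -/
def SmallOLiminf (u v : ℕ → ℝ) : Prop :=
  liminf (fun k => ((u k / v k : ℝ) : EReal)) atTop = 0

end RandomizedPD

end

/-!
Each `x^k` and `r^k` is a convex combination of the past `x̃^l` and `r̃^l`, so averaging the values
`f(x̃^l) + g(r̃^l)` with the same coefficients gives an upper bound for `f(x^k) + g(r^k)`, which,
unlike this quantity itself, changes linearly with the resampled blocks. With this bound inside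
the Lagrangian gap at `y⋆`, the gap plus a quadratic penalty on the residual `K x^k - r^k`, weighted
by `w_k ∼ k`, and the squared distances of `ŷ^k`, `x̃^k` and `r̃^k` to `y⋆`, `x⋆` and `K x⋆` add up
to a Lyapunov function. In one iteration its expectation drops by at least a constant multiple of
the expected penalized gap: this combines the prox three-point inequality for the sampled blocks,
the block descent lemma for `h` and the update of `ŷ`.

Consequently `w_k` times the expected penalized gap is bounded, which makes both the gap and the
residual `O(1/k)`, and the Lipschitz continuity of `g` converts them into the objective gap. The
expected penalized gaps are moreover summable. If `k √(log k)` times the objective gap stayed above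
`ε > 0`, then, by the square of this inequality, `1 / (k log k)` would be summable too.
-/

noncomputable section

namespace RandomizedPD

/-! ### Proper closed convex functions and their proximal operators -/

section ProperClosedConvex

variable {E : Type*} [NormedAddCommGroup E] [InnerProductSpace ℝ E] {f : E → EReal}

namespace ProperClosedConvex

theorem coe_toReal (hf : ProperClosedConvex f) {x : E} (hx : x ∈ effDom f) :
    ((f x).toReal : EReal) = f x :=
  EReal.coe_toReal (ne_of_lt hx) (hf.ne_bot x)

theorem convexOn_toReal (hf : ProperClosedConvex f) :
    ConvexOn ℝ (effDom f) (fun x => (f x).toReal) := by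
  have hle : ∀ x ∈ effDom f, ∀ y ∈ effDom f, ∀ a b : ℝ, 0 ≤ a → 0 ≤ b → a + b = 1 →
      f (a • x + b • y) ≤ ((a * (f x).toReal + b * (f y).toReal : ℝ) : EReal) := by
    intro x hx y hy a b ha hb hab
    have h := hf.convex x y a b ha hb hab
    rw [← hf.coe_toReal hx, ← hf.coe_toReal hy] at h
    exact_mod_cast h
  have hconv : Convex ℝ (effDom f) := fun x hx y hy a b ha hb hab =>
    (hle x hx y hy a b ha hb hab).trans_lt (EReal.coe_lt_top _)
  refine ⟨hconv, fun x hx y hy a b ha hb hab => ?_⟩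
  have h := hle x hx y hy a b ha hb hab
  rw [← hf.coe_toReal (hconv hx hy ha hb hab)] at h
  exact_mod_cast h

theorem const_mul (hf : ProperClosedConvex f) {b : ℝ} (hb : 0 < b) :
    ProperClosedConvex (fun x => (b : EReal) * f x) where
  ne_bot x := by
    rcases eq_or_ne (f x) ⊤ with hx | hx
    · simp [hx, EReal.coe_mul_top_of_pos hb]
    · rw [← EReal.coe_toReal hx (hf.ne_bot x), ← EReal.coe_mul]
      exact EReal.coe_ne_bot _
  dom_nonempty := by
    obtain ⟨x, hx⟩ := hf.dom_nonempty
    refine ⟨x, ?_⟩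
    change (b : EReal) * f x < ⊤
    rw [← hf.coe_toReal hx, ← EReal.coe_mul]
    exact EReal.coe_lt_top _
  closed := by
    have hcont : Continuous fun y : EReal => (b : EReal) * y :=
      continuous_iff_continuousAt.2 fun y => EReal.Tendsto.const_mul tendsto_id
        (Or.inl (EReal.coe_ne_bot b)) (Or.inl (EReal.coe_ne_top b))
    exact hcont.comp_lowerSemicontinuous hf.closed
      fun y z hyz => mul_le_mul_of_nonneg_left hyz (EReal.coe_nonneg.2 hb.le)
  convex x y s t hs ht hst := by
    have hb0 : (0 : EReal) ≤ b := EReal.coe_nonneg.2 hb.le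
    have h := mul_le_mul_of_nonneg_left (hf.convex x y s t hs ht hst) hb0
    rwa [EReal.left_distrib_of_nonneg_of_ne_top hb0 (EReal.coe_ne_top b),
      mul_left_comm, mul_left_comm (b : EReal) (t : EReal)] at h

theorem exists_sub_mul_norm_le [ProperSpace E] (hf : ProperClosedConvex f) {x₀ : E}
    (hx₀ : x₀ ∈ effDom f) :
    ∃ b c : ℝ, 0 ≤ c ∧ ∀ v, ((b - c * ‖v - x₀‖ : ℝ) : EReal) ≤ f v := by
  have hcenter : x₀ ∈ Metric.closedBall x₀ 1 := Metric.mem_closedBall_self zero_le_one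
  obtain ⟨z, -, hz⟩ := LowerSemicontinuousOn.exists_isMinOn ⟨x₀, hcenter⟩
    (isCompact_closedBall x₀ 1) (hf.closed.lowerSemicontinuousOn _)
  have hmin : ∀ w ∈ effDom f, ‖w - x₀‖ ≤ 1 → (f z).toReal ≤ (f w).toReal := fun w hw hw1 =>
    EReal.toReal_le_toReal (hz (mem_closedBall_iff_norm.2 hw1)) (hf.ne_bot z) hw.ne
  refine ⟨(f z).toReal, (f x₀).toReal - (f z).toReal,
    sub_nonneg.2 (hmin x₀ hx₀ (by simp)), fun v => ?_⟩
  by_cases hv : v ∈ effDom f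
  swap
  · have htop : f v = ⊤ := not_lt_top_iff.1 hv
    exact htop ▸ le_top
  rw [← hf.coe_toReal hv, EReal.coe_le_coe_iff]
  set R := ‖v - x₀‖ with hR
  have hR0 : 0 < 1 + R := by positivity
  have hsum : R / (1 + R) + 1 / (1 + R) = 1 := by field_simp; ring
  -- The point of the segment `[x₀, v]` at distance `R / (1 + R)` from `x₀` lies in the ball.
  have hball : ‖(R / (1 + R)) • x₀ + (1 / (1 + R)) • v - x₀‖ ≤ 1 := by
    have hw : (R / (1 + R)) • x₀ + (1 / (1 + R)) • v - x₀ = (1 / (1 + R)) • (v - x₀) := by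
      rw [eq_sub_of_add_eq hsum]; module
    rw [hw, norm_smul, ← hR, Real.norm_of_nonneg (by positivity), one_div_mul_eq_div,
      div_le_one hR0]
    linarith
  have hval := (hmin _ (hf.convexOn_toReal.1 hx₀ hv (by positivity) (by positivity) hsum)
    hball).trans (hf.convexOn_toReal.2 hx₀ hv (by positivity) (by positivity) hsum)
  simp only [smul_eq_mul] at hval
  rw [div_mul_eq_mul_div, one_div_mul_eq_div, ← add_div, le_div_iff₀ hR0] at hval
  linarith

theorem exists_isProx [ProperSpace E] (hf : ProperClosedConvex f) (x : E) :
    ∃ u, IsProx f x u := by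
  obtain ⟨x₀, hx₀⟩ := hf.dom_nonempty
  obtain ⟨b, c, hc, hlow⟩ := hf.exists_sub_mul_norm_le hx₀
  set Φ : E → EReal := fun v => f v + ((1 / 2 * ‖v - x‖ ^ 2 : ℝ) : EReal)
  have hΦ : LowerSemicontinuous Φ := hf.closed.add'
    (continuous_coe_real_ereal.comp (by fun_prop)).lowerSemicontinuous
    fun v => EReal.continuousAt_add (Or.inr (EReal.coe_ne_bot _)) (Or.inr (EReal.coe_ne_top _))
  set D := ‖x₀ - x‖ with hD
  set A := (f x₀).toReal + 1 / 2 * D ^ 2 - b + c * D with hA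
  have hfar : ∀ v, max (2 * c + 2) A ≤ ‖v - x‖ → Φ x₀ ≤ Φ v := by
    intro v hv
    obtain ⟨hvc, hvA⟩ := max_le_iff.1 hv
    have htri : ‖v - x₀‖ ≤ ‖v - x‖ + D := by
      rw [hD, norm_sub_rev x₀ x]
      exact norm_sub_le_norm_sub_add_norm_sub _ _ _
    have hquad : ‖v - x‖ ≤ ‖v - x‖ * (‖v - x‖ / 2 - c) :=
      le_mul_of_one_le_right (norm_nonneg _) (by linarith)
    have hreal : (f x₀).toReal + 1 / 2 * D ^ 2
        ≤ b - c * ‖v - x₀‖ + 1 / 2 * ‖v - x‖ ^ 2 := by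
      have := mul_le_mul_of_nonneg_left htri hc
      linarith
    calc Φ x₀ = (((f x₀).toReal + 1 / 2 * D ^ 2 : ℝ) : EReal) := by
          rw [EReal.coe_add, hf.coe_toReal hx₀]
      _ ≤ ((b - c * ‖v - x₀‖ + 1 / 2 * ‖v - x‖ ^ 2 : ℝ) : EReal) := EReal.coe_le_coe_iff.2 hreal
      _ ≤ Φ v := by
          rw [EReal.coe_add]
          exact add_le_add_left (hlow v) _
  have hmem : x₀ ∈ Metric.closedBall x (max (max (2 * c + 2) A) D) :=
    mem_closedBall_iff_norm.2 (le_max_right _ _)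
  obtain ⟨u, -, hu⟩ := LowerSemicontinuousOn.exists_isMinOn ⟨x₀, hmem⟩
    (isCompact_closedBall _ _) (hΦ.lowerSemicontinuousOn _)
  refine ⟨u, fun v => ?_⟩
  by_cases hv : v ∈ Metric.closedBall x (max (max (2 * c + 2) A) D)
  · exact hu hv
  · rw [mem_closedBall_iff_norm, not_le] at hv
    exact (hu hmem).trans (hfar v ((le_max_left _ _).trans hv.le))

theorem isProx_prox [ProperSpace E] (hf : ProperClosedConvex f) (x : E) : IsProx f x (prox f x) :=
  Classical.epsilon_spec (hf.exists_isProx x)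

theorem mem_effDom_of_isProx (hf : ProperClosedConvex f) {x u : E} (hu : IsProx f x u) :
    u ∈ effDom f := by
  obtain ⟨x₀, hx₀⟩ := hf.dom_nonempty
  by_contra h
  have hle := hu x₀
  have htop : f u = ⊤ := not_lt_top_iff.1 h
  rw [htop, EReal.top_add_coe, ← hf.coe_toReal hx₀, ← EReal.coe_add] at hle
  exact EReal.coe_ne_top _ (top_le_iff.1 hle)

theorem inner_sub_le_of_isProx (hf : ProperClosedConvex f) {x u : E} (hu : IsProx f x u) {z : E}
    (hz : z ∈ effDom f) : (f u).toReal + ⟪x - u, z - u⟫ ≤ (f z).toReal := by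
  have hud := hf.mem_effDom_of_isProx hu
  -- Compare `u` with `u + t (z - u)`, divide by `t` and let `t → 0`.
  have hsegment : ∀ t : ℝ, 0 < t → t ≤ 1 →
      (f u).toReal + ⟪x - u, z - u⟫ - (f z).toReal ≤ t * (1 / 2 * ‖z - u‖ ^ 2) := by
    intro t ht ht1
    have hsum : 1 - t + t = 1 := by ring
    have hm := hf.convexOn_toReal.1 hud hz (sub_nonneg.2 ht1) ht.le hsum
    have hc := hf.convexOn_toReal.2 hud hz (sub_nonneg.2 ht1) ht.le hsum
    have hprox := hu ((1 - t) • u + t • z)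
    rw [← hf.coe_toReal hud, ← hf.coe_toReal hm, ← EReal.coe_add, ← EReal.coe_add,
      EReal.coe_le_coe_iff] at hprox
    have hdiff : (1 - t) • u + t • z - x = t • (z - u) - (x - u) := by module
    rw [hdiff, norm_sub_rev u x, norm_sub_sq_real (t • (z - u)), real_inner_smul_left, norm_smul,
      mul_pow, Real.norm_eq_abs, sq_abs, real_inner_comm] at hprox
    simp only [smul_eq_mul] at hc
    refine le_of_mul_le_mul_left ?_ ht
    linarith
  have hlim : Tendsto (fun t : ℝ => t * (1 / 2 * ‖z - u‖ ^ 2)) (nhdsWithin 0 (Set.Ioi 0))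
      (nhds 0) := by
    have hid : Tendsto (fun t : ℝ => t) (nhdsWithin 0 (Set.Ioi 0)) (nhds 0) :=
      tendsto_id.mono_left nhdsWithin_le_nhds
    simpa using hid.mul_const (1 / 2 * ‖z - u‖ ^ 2)
  have := ge_of_tendsto hlim <| by
    filter_upwards [Ioc_mem_nhdsGT zero_lt_one] with t ht using hsegment t ht.1 ht.2
  linarith

end ProperClosedConvex

/-- The forward–backward point `prox_{bf}(x - bΔ)`: a gradient step of length `b` along `-Δ`
followed by a proximal step on `f`. -/
def forwardBackward (f : E → EReal) (b : ℝ) (Δ x : E) : E :=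
  prox (fun u => (b : EReal) * f u) (x - b • Δ)

theorem effDom_const_mul {X : Type*} (f : X → EReal) {b : ℝ} (hb : 0 < b) :
    effDom (fun x => (b : EReal) * f x) = effDom f := by
  ext x
  change (b : EReal) * f x < ⊤ ↔ f x < ⊤
  induction f x with
  | bot => simp [EReal.coe_mul_bot_of_pos hb]
  | top => simp [EReal.coe_mul_top_of_pos hb]
  | coe a => exact iff_of_true (EReal.coe_lt_top (b * a)) (EReal.coe_lt_top a)

namespace ProperClosedConvex

variable [ProperSpace E] {b : ℝ}

theorem forwardBackward_mem_effDom (hf : ProperClosedConvex f) (hb : 0 < b) (Δ x : E) :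
    forwardBackward f b Δ x ∈ effDom f := by
  rw [← effDom_const_mul f hb]
  exact (hf.const_mul hb).mem_effDom_of_isProx ((hf.const_mul hb).isProx_prox _)

theorem forwardBackward_three_point (hf : ProperClosedConvex f) (hb : 0 < b) {Δ x z u : E}
    (hz : z ∈ effDom f) (hprox : forwardBackward f b Δ x = u) :
    (f u).toReal + ⟪Δ, u - z⟫ + 1 / (2 * b) * (‖u - x‖ ^ 2 + ‖u - z‖ ^ 2 - ‖x - z‖ ^ 2)
      ≤ (f z).toReal := by
  have hopt := (hf.const_mul hb).inner_sub_le_of_isProx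
    (hprox ▸ (hf.const_mul hb).isProx_prox _ : IsProx _ (x - b • Δ) u)
    ((effDom_const_mul f hb).symm ▸ hz)
  have hnorm : 2 * ⟪x - u, z - u⟫ = ‖u - x‖ ^ 2 + ‖u - z‖ ^ 2 - ‖x - z‖ ^ 2 := by
    rw [← sub_sub_sub_cancel_right x z u, norm_sub_sq_real (x - u), norm_sub_rev u x,
      norm_sub_rev u z]
    ring
  rw [EReal.toReal_mul, EReal.toReal_mul, EReal.toReal_coe, sub_right_comm, inner_sub_left,
    real_inner_smul_left, ← neg_sub u z, inner_neg_right, inner_neg_right] at hopt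
  rw [← hnorm, ← neg_sub u z, inner_neg_right]
  refine le_of_mul_le_mul_left ?_ hb
  field_simp
  linarith

end ProperClosedConvex

end ProperClosedConvex

/-! ### First-order inequalities -/

section FirstOrder

variable {E : Type*} [NormedAddCommGroup E] [InnerProductSpace ℝ E] [CompleteSpace E] {h : E → ℝ}

theorem hasDerivAt_comp_add_smul {x v : E} {t : ℝ} (hd : DifferentiableAt ℝ h (x + t • v)) :
    HasDerivAt (fun s : ℝ => h (x + s • v)) ⟪∇ h (x + t • v), v⟫ t := by
  have hline : HasDerivAt (fun s : ℝ => x + s • v) v t := by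
    simpa using ((hasDerivAt_id t).smul_const v).const_add x
  rw [inner_gradient_left]
  exact hd.hasFDerivAt.comp_hasDerivAt t hline

theorem add_inner_gradient_le_of_convexOn (hc : ConvexOn ℝ Set.univ h) {x : E}
    (hd : DifferentiableAt ℝ h x) (z : E) : h x + ⟪∇ h x, z - x⟫ ≤ h z := by
  have hder : HasDerivAt (fun s : ℝ => h (x + s • (z - x))) ⟪∇ h x, z - x⟫ 0 := by
    have h0 : x + (0 : ℝ) • (z - x) = x := by simp
    have := hasDerivAt_comp_add_smul (t := 0) (v := z - x) (h0.symm ▸ hd)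
    rwa [h0] at this
  have hline : ConvexOn ℝ Set.univ (fun s : ℝ => h (x + s • (z - x))) := by
    have := hc.comp_affineMap (AffineMap.lineMap x z)
    simpa [Function.comp_def, AffineMap.lineMap_apply, add_comm] using this
  have hslope := hline.le_slope_of_hasDerivAt (Set.mem_univ 0) (Set.mem_univ 1) zero_lt_one hder
  simp only [slope_def_field, zero_smul, add_zero, one_smul, sub_zero, div_one,
    add_sub_cancel] at hslope
  linarith

theorem le_add_inner_gradient_add_of_inner_gradient_sub_le (hd : Differentiable ℝ h) (x v : E)
    {C : ℝ} (hC : ∀ t ∈ Set.Ioo (0 : ℝ) 1, ⟪∇ h (x + t • v) - ∇ h x, v⟫ ≤ C * t) :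
    h (x + v) ≤ h x + ⟪∇ h x, v⟫ + C / 2 := by
  set ψ : ℝ → ℝ := fun s => h (x + s • v) - s * ⟪∇ h x, v⟫ - C / 2 * s ^ 2
  have hder : ∀ t : ℝ, HasDerivAt ψ (⟪∇ h (x + t • v), v⟫ - ⟪∇ h x, v⟫ - C * t) t := fun t =>
    (((hasDerivAt_comp_add_smul (hd _)).sub ((hasDerivAt_id t).mul_const ⟪∇ h x, v⟫)).sub
      (((hasDerivAt_id t).pow 2).const_mul (C / 2))).congr_deriv (by norm_num; ring)
  have hanti : AntitoneOn ψ (Set.Icc 0 1) := by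
    refine antitoneOn_of_deriv_nonpos (convex_Icc 0 1)
      (fun t _ => (hder t).continuousAt.continuousWithinAt)
      (fun t _ => (hder t).differentiableAt.differentiableWithinAt) fun t ht => ?_
    have := hC t (interior_Icc (a := (0 : ℝ)) ▸ ht)
    rw [inner_sub_left] at this
    rw [(hder t).deriv]
    linarith
  have := hanti (Set.left_mem_Icc.2 zero_le_one) (Set.right_mem_Icc.2 zero_le_one) zero_le_one
  simp only [ψ, one_smul, zero_smul, add_zero] at this
  linarith

end FirstOrder

/-! ### Fenchel duality for a continuous outer function -/

section Duality

variable {X Y : Type*} [NormedAddCommGroup X] [NormedSpace ℝ X] [NormedAddCommGroup Y]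

theorem exists_lt_add_inner_of_convex_of_isOpen [InnerProductSpace ℝ Y] [CompleteSpace Y]
    {A : Set (Y × ℝ)} (hconv : Convex ℝ A) (hopen : IsOpen A) {a b : ℝ} (hab : a < b)
    (ha : (0, a) ∉ A) (hb : (0, b) ∈ A) : ∃ y : Y, ∀ p ∈ A, a < p.2 + ⟪y, p.1⟫ := by
  obtain ⟨ℓ, hℓ⟩ := geometric_hahn_banach_open_point hconv hopen ha
  set s : ℝ := ℓ (0, 1)
  have hsplit : ∀ (u : Y) (t : ℝ), ℓ (u, t) = ℓ (u, 0) + t * s := by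
    intro u t
    have : ((u, t) : Y × ℝ) = (u, 0) + t • ((0 : Y), (1 : ℝ)) := by simp
    rw [this, map_add, map_smul, smul_eq_mul]
  have hzero : ℓ ((0 : Y), (0 : ℝ)) = 0 := map_zero ℓ
  -- The separating hyperplane is not vertical because `A` contains a point above `(0, a)`.
  have hs0 : s < 0 := by
    have := hℓ _ hb
    rw [hsplit 0 a, hsplit 0 b] at this
    nlinarith
  refine ⟨(InnerProductSpace.toDual ℝ Y).symm (s⁻¹ • ℓ.comp (ContinuousLinearMap.inl ℝ Y ℝ)),
    fun ⟨u, t⟩ hp => ?_⟩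
  have hlt := hℓ _ hp
  rw [hsplit u t, hsplit 0 a, hzero, zero_add] at hlt
  rw [InnerProductSpace.toDual_symm_apply]
  change a < t + s⁻¹ * ℓ (u, 0)
  have : t + s⁻¹ * ℓ (u, 0) = (ℓ (u, 0) + t * s) / s := by
    rw [add_div, mul_div_cancel_right₀ t hs0.ne]; ring
  rwa [this, lt_div_iff_of_neg hs0]

variable [NormedSpace ℝ Y]

/-- The strict epigraph of the value function `u ↦ inf_{x ∈ D} φ x + g (K x - u)` of the perturbed
problem `min_{x ∈ D} φ x + g (K x)`. -/
def perturbationEpigraph (D : Set X) (φ : X → ℝ) (g : Y → ℝ) (K : X →L[ℝ] Y) : Set (Y × ℝ) :=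
  {a | ∃ x ∈ D, φ x + g (K x - a.1) < a.2}

variable {D : Set X} {φ : X → ℝ} {g : Y → ℝ} (K : X →L[ℝ] Y)

theorem isOpen_perturbationEpigraph (hg : Continuous g) :
    IsOpen (perturbationEpigraph D φ g K) := by
  have : perturbationEpigraph D φ g K
      = ⋃ x ∈ D, {a : Y × ℝ | φ x + g (K x - a.1) < a.2} := by
    ext a
    simp [perturbationEpigraph]
  rw [this]
  exact isOpen_biUnion fun x _ => isOpen_lt (by fun_prop) continuous_snd

theorem convex_perturbationEpigraph (hφ : ConvexOn ℝ D φ) (hg : ConvexOn ℝ Set.univ g) :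
    Convex ℝ (perturbationEpigraph D φ g K) := by
  have hjoint : ConvexOn ℝ (Prod.fst ⁻¹' D) fun p : X × Y => φ p.1 + g (K p.1 - p.2) := by
    refine (hφ.comp_linearMap (LinearMap.fst ℝ X Y)).add ?_
    refine (hg.comp_linearMap ((K : X →ₗ[ℝ] Y) ∘ₗ LinearMap.fst ℝ X Y
      - LinearMap.snd ℝ X Y)).subset (Set.subset_univ _) ?_
    exact hφ.1.linear_preimage (LinearMap.fst ℝ X Y)
  have himage : perturbationEpigraph D φ g K = (LinearMap.snd ℝ X Y).prodMap LinearMap.id ''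
      {p : (X × Y) × ℝ | p.1 ∈ Prod.fst ⁻¹' D ∧ φ p.1.1 + g (K p.1.1 - p.1.2) < p.2} := by
    ext ⟨u, t⟩
    simp [perturbationEpigraph]
  rw [himage]
  exact hjoint.convex_strict_epigraph.linear_image _

theorem exists_saddle_multiplier {Y : Type*} [NormedAddCommGroup Y] [InnerProductSpace ℝ Y]
    [CompleteSpace Y] {g : Y → ℝ} (K : X →L[ℝ] Y) (hφ : ConvexOn ℝ D φ)
    (hg : ConvexOn ℝ Set.univ g) (hgc : Continuous g) {xs : X} (hxs : xs ∈ D)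
    (hmin : ∀ x ∈ D, φ xs + g (K xs) ≤ φ x + g (K x)) :
    ∃ y : Y, ∀ x ∈ D, ∀ r, φ xs + g (K xs) ≤ φ x + g r + ⟪y, K x - r⟫ := by
  have hoptimal : ((0 : Y), φ xs + g (K xs)) ∉ perturbationEpigraph D φ g K := by
    rintro ⟨x, hx, h⟩
    simp only [sub_zero] at h
    exact (hmin x hx).not_gt h
  have habove : ((0 : Y), φ xs + g (K xs) + 1) ∈ perturbationEpigraph D φ g K :=
    ⟨xs, hxs, by simp⟩
  obtain ⟨y, hy⟩ := exists_lt_add_inner_of_convex_of_isOpen (convex_perturbationEpigraph K hφ hg)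
    (isOpen_perturbationEpigraph K hgc) (lt_add_one _) hoptimal habove
  refine ⟨y, fun x hx r => le_of_forall_pos_le_add fun ε hε => ?_⟩
  have := hy (K x - r, φ x + g r + ε) ⟨x, hx, by simpa using hε⟩
  linarith

end Duality

/-! ### Averages and real sequences -/

section Sequences

/-- Each `X k` is a convex combination of `Z 0, …, Z k` in which `Z k` has weight `w k`. -/
theorem averaged_mem_of_convex {V : Type*} [AddCommGroup V] [Module ℝ V] {C : Set V}
    (hC : Convex ℝ C) {τ w : ℕ → ℝ} (hτ : ∀ k, τ k ≤ 1) (hw0 : w 0 = 1) (hw : ∀ k, 0 ≤ w k)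
    (hw1 : ∀ k, w k ≤ 1) (hstep : ∀ k, w (k + 1) ≤ (1 - τ k) * w k + τ k) {X Z : ℕ → V}
    (hZ : ∀ k, Z k ∈ C) (h0 : X 0 = Z 0)
    (hX : ∀ k, X (k + 1) = (1 - τ k) • X k + τ k • Z k + w (k + 1) • (Z (k + 1) - Z k)) (k : ℕ) :
    X k ∈ C := by
  have hcomb : ∃ c ∈ C, X k = w k • Z k + (1 - w k) • c := by
    induction k with
    | zero => exact ⟨Z 0, hZ 0, by rw [h0, hw0]; simp⟩
    | succ k ih =>
      obtain ⟨c, hc, hXk⟩ := ih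
      have ha : 0 ≤ (1 - τ k) * w k + τ k - w (k + 1) := sub_nonneg.2 (hstep k)
      have hb : 0 ≤ (1 - τ k) * (1 - w k) :=
        mul_nonneg (sub_nonneg.2 (hτ k)) (sub_nonneg.2 (hw1 k))
      obtain ⟨z, hz, hzeq⟩ : ((1 - τ k) * w k + τ k - w (k + 1)) • Z k
          + ((1 - τ k) * (1 - w k)) • c
          ∈ ((1 - τ k) * w k + τ k - w (k + 1) + (1 - τ k) * (1 - w k)) • C :=
        hC.add_smul ha hb ▸
          Set.add_mem_add (Set.smul_mem_smul_set (hZ k)) (Set.smul_mem_smul_set hc)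
      refine ⟨z, hz, ?_⟩
      have hsum : (1 - τ k) * w k + τ k - w (k + 1) + (1 - τ k) * (1 - w k) = 1 - w (k + 1) := by
        ring
      rw [← hsum, show _ • z = _ from hzeq, hX k, hXk]
      module
  obtain ⟨c, hc, hXk⟩ := hcomb
  rw [hXk]
  exact hC (hZ k) hc (hw k) (sub_nonneg.2 (hw1 k)) (by ring)

theorem add_sum_range_le_of_add_le {V d : ℕ → ℝ} (h : ∀ k, V (k + 1) + d k ≤ V k) (k : ℕ) :
    V k + ∑ l ∈ Finset.range k, d l ≤ V 0 := by
  induction k with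
  | zero => simp
  | succ k ih =>
    rw [Finset.sum_range_succ]
    linarith [h k]

theorem summable_of_add_le {V d : ℕ → ℝ} (hV : ∀ k, 0 ≤ V k) (hd : ∀ k, 0 ≤ d k)
    (h : ∀ k, V (k + 1) + d k ≤ V k) : Summable d :=
  summable_of_sum_range_le hd fun k =>
    (le_add_of_nonneg_left (hV k)).trans (add_sum_range_le_of_add_le h k)

theorem not_summable_one_div_mul_log :
    ¬ Summable (fun k : ℕ => 1 / ((k : ℝ) * Real.log k)) := by
  intro h
  have hlog2 : Real.log 2 ≠ 0 := (Real.log_pos one_lt_two).ne'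
  -- Cauchy condensation needs monotonicity for all indices, so truncate the index at `2`.
  have hmax : Summable (fun k : ℕ => 1 / (((max k 2 : ℕ) : ℝ) * Real.log (max k 2 : ℕ))) := by
    refine (summable_nat_add_iff 2).1 (((summable_nat_add_iff 2).2 h).congr fun k => ?_)
    rw [max_eq_left (by omega)]
  have hlog : ∀ k : ℕ, 0 < Real.log (max k 2 : ℕ) := fun k =>
    Real.log_pos (by exact_mod_cast lt_max_of_lt_right one_lt_two)
  rw [← summable_condensed_iff_of_nonneg] at hmax
  · have hharmonic : Summable (fun k : ℕ => (Real.log 2)⁻¹ * (1 / ((k + 1 : ℕ) : ℝ))) := by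
      refine ((summable_nat_add_iff 1).2 hmax).congr fun k => ?_
      rw [max_eq_left (Nat.le_self_pow k.succ_ne_zero 2)]
      push_cast
      rw [Real.log_pow]
      push_cast
      field_simp
    exact Real.not_summable_one_div_natCast ((summable_nat_add_iff 1).1
      ((summable_mul_left_iff (inv_ne_zero hlog2)).1 hharmonic))
  · intro k
    have := hlog k
    positivity
  · intro a b _ hab
    have hle : ((max a 2 : ℕ) : ℝ) ≤ (max b 2 : ℕ) := by exact_mod_cast max_le_max_right 2 hab
    have hpos : (0 : ℝ) < (max a 2 : ℕ) := by positivity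
    have hloga := hlog a
    have := Real.log_le_log hpos hle
    gcongr

theorem sq_mul_one_div_mul_log_le {k a b A ε : ℝ} (hk : 1 < k) (ha : 0 ≤ a) (haA : k * a ≤ A)
    (hε : 0 ≤ ε) (h : ε ≤ k * √(Real.log k) * (a + b)) :
    ε ^ 2 * (1 / (k * Real.log k)) ≤ 2 * A * a + 2 * (k * b ^ 2) := by
  have hlog : 0 < Real.log k := Real.log_pos hk
  have hk0 : 0 < k := by linarith
  have hsq : k * (a + b) ^ 2 ≤ 2 * A * a + 2 * (k * b ^ 2) := by
    have := mul_le_mul_of_nonneg_right haA ha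
    nlinarith [mul_nonneg hk0.le (sq_nonneg (a - b))]
  rw [mul_one_div, div_le_iff₀ (mul_pos hk0 hlog)]
  calc ε ^ 2 ≤ (k * √(Real.log k) * (a + b)) ^ 2 := by gcongr
    _ = k * (a + b) ^ 2 * (k * Real.log k) := by
        rw [mul_pow, mul_pow, Real.sq_sqrt hlog.le]; ring
    _ ≤ (2 * A * a + 2 * (k * b ^ 2)) * (k * Real.log k) := by gcongr

theorem frequently_mul_sqrt_log_lt {a b : ℕ → ℝ} {A : ℝ} (ha0 : ∀ k, 0 ≤ a k)
    (ha : Summable a) (haA : ∀ k : ℕ, k * a k ≤ A) (hb : Summable fun k : ℕ => k * b k ^ 2)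
    {ε : ℝ} (hε : 0 < ε) : ∃ᶠ k : ℕ in atTop, k * √(Real.log k) * (a k + b k) < ε := by
  intro hcon
  have hsum : Summable fun k : ℕ => 2 * A * a k + 2 * (k * b k ^ 2) :=
    (ha.mul_left _).add (hb.mul_left _)
  have hlog : Summable fun k : ℕ => ε ^ 2 * (1 / ((k : ℝ) * Real.log k)) := by
    refine hsum.of_norm_bounded_eventually_nat ?_
    filter_upwards [hcon, eventually_gt_atTop 1] with k hk hk1
    have hk1' : (1 : ℝ) < k := by exact_mod_cast hk1
    have := Real.log_pos hk1'
    rw [Real.norm_of_nonneg (by positivity)]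
    exact sq_mul_one_div_mul_log_le hk1' (ha0 k) (haA k) hε.le (not_lt.1 hk)
  exact not_summable_one_div_mul_log ((summable_mul_left_iff (by positivity)).1 hlog)

theorem liminf_coe_eq_zero {u : ℕ → ℝ} (h0 : ∀ k, 0 ≤ u k)
    (h : ∀ ε : ℝ, 0 < ε → ∃ᶠ k in atTop, u k < ε) :
    liminf (fun k => ((u k : ℝ) : EReal)) atTop = 0 := by
  refine le_antisymm (EReal.le_of_forall_lt_iff_le.1 fun ε hε => ?_) (le_liminf_of_le
    (by isBoundedDefault) (Eventually.of_forall fun k => EReal.coe_nonneg.2 (h0 k)))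
  exact liminf_le_of_frequently_le' ((h ε (EReal.coe_pos.1 hε)).mono fun k hk =>
    EReal.coe_le_coe_iff.2 hk.le)

end Sequences

/-! ### Randomly driven recursions -/

section Orbit

variable {ι α Ω : Type*}

/-- The orbit of `a₀` under the maps `stp k (u k)`, driven by the sequence `u`. -/
def orbit (stp : ℕ → ι → α → α) (a₀ : α) (u : ℕ → ι) : ℕ → α
  | 0 => a₀
  | k + 1 => stp k (u k) (orbit stp a₀ u k)

theorem factorsThrough_orbit (stp : ℕ → ι → α → α) (a₀ : α) (k : ℕ) :
    Function.FactorsThrough (fun u => orbit stp a₀ u k) (Finset.range k).restrict := by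
  intro u v huv
  have hagree : ∀ l < k, u l = v l := fun l hl => congrFun huv ⟨l, Finset.mem_range.2 hl⟩
  clear huv
  induction k with
  | zero => rfl
  | succ k ih =>
    simp only [orbit] at ih ⊢
    rw [ih fun l hl => hagree l (by omega), hagree k (by omega)]

theorem exists_orbit_eq_comp_restrict (stp : ℕ → ι → α → α) (a₀ : α) (k : ℕ) :
    ∃ T : (Finset.range k → ι) → α,
      ∀ u, orbit stp a₀ u k = T ((Finset.range k).restrict u) := by
  have : Nonempty α := ⟨a₀⟩
  obtain ⟨T, hT⟩ := (Function.factorsThrough_iff _).1 (factorsThrough_orbit stp a₀ k)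
  exact ⟨T, fun u => congrFun hT u⟩

variable [MeasurableSpace ι] [MeasurableSingletonClass ι] [MeasurableSpace Ω] {μ : Measure Ω}

theorem integral_comp_prodMk_of_indepFun [Fintype ι] {κ : Type*} [Finite κ] [MeasurableSpace κ]
    [MeasurableSingletonClass κ] [IsFiniteMeasure μ] {X : Ω → κ} {Y : Ω → ι} (hX : Measurable X)
    (hY : Measurable Y) (hind : IndepFun X Y μ) (f : κ → ι → ℝ) :
    ∫ ω, f (X ω) (Y ω) ∂μ = ∫ ω, ∑ y, μ.real {ω' | Y ω' = y} * f (X ω) y ∂μ := by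
  have hlaw := (indepFun_iff_map_prod_eq_prod_map_map hX.aemeasurable hY.aemeasurable).1 hind
  have hf : Measurable (Function.uncurry f) := measurable_of_finite _
  calc ∫ ω, f (X ω) (Y ω) ∂μ
      = ∫ p, Function.uncurry f p ∂(μ.map fun ω => (X ω, Y ω)) :=
        (integral_map (hX.prodMk hY).aemeasurable hf.aestronglyMeasurable).symm
    _ = ∫ x, ∫ y, f x y ∂μ.map Y ∂μ.map X := by
        rw [hlaw]
        exact integral_prod _ (Integrable.of_finite)
    _ = ∫ x, ∑ y, μ.real {ω | Y ω = y} * f x y ∂μ.map X := by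
        refine integral_congr_ae (Eventually.of_forall fun x =>
          (integral_fintype Integrable.of_finite).trans (Finset.sum_congr rfl fun y _ => ?_))
        rw [map_measureReal_apply hY (measurableSet_singleton y), smul_eq_mul]
        rfl
    _ = ∫ ω, ∑ y, μ.real {ω' | Y ω' = y} * f (X ω) y ∂μ :=
        integral_map hX.aemeasurable (measurable_of_finite _).aestronglyMeasurable

variable {ξ : ℕ → Ω → ι}

theorem integrable_orbit [Finite ι] [IsFiniteMeasure μ] (hξ : ∀ k, Measurable (ξ k))
    (stp : ℕ → ι → α → α) (a₀ : α) (Φ : α → ℝ) (k : ℕ) :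
    Integrable (fun ω => Φ (orbit stp a₀ (fun l => ξ l ω) k)) μ := by
  obtain ⟨T, hT⟩ := exists_orbit_eq_comp_restrict stp a₀ k
  simp only [hT]
  have hhist : Measurable fun ω => (Finset.range k).restrict fun l => ξ l ω :=
    measurable_pi_lambda _ fun l => hξ l
  exact (Integrable.of_finite (f := fun H => Φ (T H))).comp_measurable hhist

theorem integral_orbit_succ [Fintype ι] [IsFiniteMeasure μ] (hξ : ∀ k, Measurable (ξ k))
    (hind : iIndepFun ξ μ) (stp : ℕ → ι → α → α) (a₀ : α) (Φ : α → ℝ) (k : ℕ) :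
    ∫ ω, Φ (orbit stp a₀ (fun l => ξ l ω) (k + 1)) ∂μ =
      ∫ ω, ∑ y, μ.real {ω' | ξ k ω' = y}
        * Φ (stp k y (orbit stp a₀ (fun l => ξ l ω) k)) ∂μ := by
  obtain ⟨T, hT⟩ := exists_orbit_eq_comp_restrict stp a₀ k
  set H : Ω → Finset.range k → ι := fun ω => (Finset.range k).restrict fun l => ξ l ω
  have hH : IndepFun H (ξ k) μ :=
    (hind.indepFun_finset (Finset.range k) {k} (by simp) hξ).comp measurable_id
      (measurable_pi_apply (⟨k, Finset.mem_singleton_self k⟩ : ({k} : Finset ℕ)))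
  simp only [orbit, hT]
  exact integral_comp_prodMk_of_indepFun (X := H) (measurable_pi_lambda _ fun l => hξ l) (hξ k)
    hH fun H y => Φ (stp k y (T H))

end Orbit

namespace Sampling

variable {n m : ℕ} {S : Params n m} {Ω : Type*} [MeasurableSpace Ω] {μ : Measure Ω}
  {is : ℕ → Ω → Fin m} {js : ℕ → Ω → Fin n}

theorem measurable_prodMk (hsamp : Sampling S μ is js) (k : ℕ) :
    Measurable fun ω => (is k ω, js k ω) :=
  (hsamp.meas_i k).prodMk (hsamp.meas_j k)

theorem law_prodMk (hsamp : Sampling S μ is js) (k : ℕ) (i : Fin m) (j : Fin n) :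
    μ.real {ω | (is k ω, js k ω) = (i, j)} = S.qh i * S.q j := by
  rw [← hsamp.law_i k i, ← hsamp.law_j k j]
  simp only [Prod.mk.injEq, measureReal_def, ← ENNReal.toReal_mul]
  exact congrArg ENNReal.toReal ((hsamp.indep_ij k).measure_inter_preimage_eq_mul _ _
    (MeasurableSet.singleton i) (MeasurableSet.singleton j))

theorem integral_orbit_succ [IsFiniteMeasure μ] (hsamp : Sampling S μ is js) {α : Type*}
    (stp : ℕ → Fin m × Fin n → α → α) (a₀ : α) (Φ : α → ℝ) (k : ℕ) :
    ∫ ω, Φ (orbit stp a₀ (fun l => (is l ω, js l ω)) (k + 1)) ∂μ =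
      ∫ ω, ∑ i, ∑ j, S.qh i * S.q j
        * Φ (stp k (i, j) (orbit stp a₀ (fun l => (is l ω, js l ω)) k)) ∂μ := by
  rw [RandomizedPD.integral_orbit_succ hsamp.measurable_prodMk hsamp.indep_iter]
  simp only [Fintype.sum_prod_type, hsamp.law_prodMk]

end Sampling

/-! ### Blocks and parameters -/

section Blocks

theorem inner_piLp_single_right {ι : Type*} [Fintype ι] [DecidableEq ι] {E : ι → Type*}
    [∀ i, NormedAddCommGroup (E i)] [∀ i, InnerProductSpace ℝ (E i)] (a : PiLp 2 E) (i : ι)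
    (v : E i) : ⟪a, PiLp.single 2 i v⟫ = ⟪a i, v⟫ := by
  rw [PiLp.inner_apply, Finset.sum_eq_single i]
  · rw [PiLp.single_eq_same]
  · intro l _ hl
    rw [PiLp.single_eq_of_ne 2 hl, inner_zero_right]
  · simp

theorem smul_piLp_single {ι R : Type*} [DecidableEq ι] {E : ι → Type*} [Semiring R]
    [∀ i, SeminormedAddCommGroup (E i)] [∀ i, Module R (E i)] (t : R) (i : ι) (v : E i) :
    t • (PiLp.single 2 i v : PiLp 2 E) = PiLp.single 2 i (t • v) := by
  simp only [← PiLp.toLp_single, ← WithLp.toLp_smul, ← Pi.single_smul]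

variable {n : ℕ} {p : Fin n → ℕ} (x : BlockSpace p) (j : Fin n) (u : EuclideanSpace ℝ (Fin (p j)))

theorem setBlock_apply_same : setBlock x j u j = u := by simp [setBlock]

theorem setBlock_apply_of_ne {l : Fin n} (hl : l ≠ j) : setBlock x j u l = x l := by
  simp [setBlock, hl]

theorem setBlock_sub_self : setBlock x j u - x = PiLp.single 2 j (u - x j) := by
  ext l a
  by_cases hl : l = j
  · subst hl
    simp [setBlock]
  · simp [setBlock, hl]

theorem sum_setBlock (φ : (l : Fin n) → EuclideanSpace ℝ (Fin (p l)) → ℝ) :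
    ∑ l, φ l (setBlock x j u l) = ∑ l, φ l (x l) + (φ j u - φ j (x j)) := by
  rw [← sub_eq_iff_eq_add', ← Finset.sum_sub_distrib, Finset.sum_eq_single j]
  · rw [setBlock_apply_same]
  · intro l _ hl
    rw [setBlock_apply_of_ne x j u hl, sub_self]
  · simp

theorem wNormSq_setBlock_sub (w : Fin n → ℝ) (z : BlockSpace p) :
    wNormSq w (setBlock x j u - z) =
      wNormSq w (x - z) + w j * (‖u - z j‖ ^ 2 - ‖x j - z j‖ ^ 2) := by
  rw [mul_sub]
  exact sum_setBlock x j u fun l v => w l * ‖v - z l‖ ^ 2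

theorem wNormSq_nonneg {w : Fin n → ℝ} (hw : ∀ j, 0 ≤ w j) (x : BlockSpace p) :
    0 ≤ wNormSq w x :=
  Finset.sum_nonneg fun j _ => mul_nonneg (hw j) (sq_nonneg _)

theorem blockDiag_single (w : Fin n → ℝ) :
    blockDiag p w (PiLp.single 2 j u) = PiLp.single 2 j (w j • u) := by
  ext l a
  by_cases hl : l = j
  · subst hl
    simp [blockDiag]
  · simp [blockDiag, hl]

end Blocks

namespace Params

variable {n m : ℕ} (S : Params n m) (P : Problem n m)

/-- The curvature `1 / β_k = L^h_σ + 4 L̄_σ ρ_k` of the quadratic model of iteration `k`, in the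
metric weighted by `σ`. -/
def curvature (k : ℕ) : ℝ := S.Lhσ + 4 * S.Lbar P * S.ρ k

theorem τ₀_le_q (j : Fin n) : S.τ₀ ≤ S.q j :=
  (min_le_right _ _).trans (ciInf_le (Set.finite_range _).bddBelow j)

theorem τ₀_le_qh (i : Fin m) : S.τ₀ ≤ S.qh i :=
  (min_le_left _ _).trans (ciInf_le (Set.finite_range _).bddBelow i)

theorem Lbar_nonneg : 0 ≤ S.Lbar P := sq_nonneg _

namespace Admissible

variable {S} {P}

theorem nonempty_n (hS : S.Admissible) : Nonempty (Fin n) := by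
  by_contra h
  have := not_nonempty_iff.1 h
  simpa using hS.q_sum

theorem nonempty_m (hS : S.Admissible) : Nonempty (Fin m) := by
  by_contra h
  have := not_nonempty_iff.1 h
  simpa using hS.qh_sum

theorem τ₀_pos (hS : S.Admissible) : 0 < S.τ₀ := by
  have := hS.nonempty_n
  have := hS.nonempty_m
  obtain ⟨i, hi⟩ := exists_eq_ciInf_of_finite (f := S.qh)
  obtain ⟨j, hj⟩ := exists_eq_ciInf_of_finite (f := S.q)
  rw [τ₀, ← hi, ← hj]
  exact lt_min (hS.qh_pos i) (hS.q_pos j)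

theorem τ₀_le_one (hS : S.Admissible) : S.τ₀ ≤ 1 := by
  obtain ⟨j⟩ := hS.nonempty_n
  refine (S.τ₀_le_q j).trans ?_
  rw [← hS.q_sum]
  exact Finset.single_le_sum (fun l _ => (hS.q_pos l).le) (Finset.mem_univ j)

theorem c_pos (hS : S.Admissible) : 0 < S.c := one_pos.trans hS.one_lt_c

theorem add_c_pos (hS : S.Admissible) (k : ℕ) : 0 < k + S.c :=
  add_pos_of_nonneg_of_pos k.cast_nonneg hS.c_pos

theorem τ_pos (hS : S.Admissible) (k : ℕ) : 0 < S.τ k :=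
  div_pos (mul_pos hS.c_pos hS.τ₀_pos) (hS.add_c_pos k)

theorem τ_le_τ₀ (hS : S.Admissible) (k : ℕ) : S.τ k ≤ S.τ₀ := by
  rw [τ, mul_comm, mul_div_assoc]
  exact mul_le_of_le_one_right hS.τ₀_pos.le
    ((div_le_one (hS.add_c_pos k)).2 (le_add_of_nonneg_left k.cast_nonneg))

theorem τ_le_one (hS : S.Admissible) (k : ℕ) : S.τ k ≤ 1 := (hS.τ_le_τ₀ k).trans hS.τ₀_le_one

theorem ρ_pos (hS : S.Admissible) (k : ℕ) : 0 < S.ρ k :=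
  div_pos (mul_pos hS.ρ₀_pos hS.τ₀_pos) (hS.τ_pos k)

theorem L_le (hS : S.Admissible) (j : Fin n) : S.L j ≤ S.Lhσ * S.σ j := by
  rw [← div_le_iff₀ (hS.σ_pos j)]
  exact le_ciSup (f := fun j => S.L j / S.σ j) (Set.finite_range _).bddAbove j

theorem Lhσ_nonneg (hS : S.Admissible) (hL : ∀ j, 0 ≤ S.L j) : 0 ≤ S.Lhσ :=
  Real.iSup_nonneg fun j => div_nonneg (hL j) (hS.σ_pos j).le

theorem curvature_nonneg (hS : S.Admissible) (hL : ∀ j, 0 ≤ S.L j) (k : ℕ) :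
    0 ≤ S.curvature P k :=
  add_nonneg (hS.Lhσ_nonneg hL)
    (mul_nonneg (mul_nonneg zero_le_four (S.Lbar_nonneg P)) (hS.ρ_pos k).le)

theorem curvature_pos (hS : S.Admissible) (hL : ∀ j, 0 ≤ S.L j)
    (hβ : 0 < S.Lhσ ∨ 0 < S.Lbar P) (k : ℕ) : 0 < S.curvature P k := by
  have h1 := hS.Lhσ_nonneg hL
  have h2 := S.Lbar_nonneg P
  have h3 := hS.ρ_pos k
  rw [curvature]
  rcases hβ with h | h <;> positivity

theorem norm_sq_K_single_le (hS : S.Admissible) (j : Fin n)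
    (v : EuclideanSpace ℝ (Fin (P.p j))) :
    ‖P.K (PiLp.single 2 j v)‖ ^ 2 ≤ S.Lbar P * (S.σ j * ‖v‖ ^ 2) := by
  have hσ := hS.σ_pos j
  set A := P.K ∘L blockDiag P.p (fun j => 1 / √(S.σ j)) with hA
  have hKA : P.K (PiLp.single 2 j v) = A (PiLp.single 2 j (√(S.σ j) • v)) := by
    rw [hA, ContinuousLinearMap.comp_apply, blockDiag_single, smul_smul,
      one_div_mul_cancel (Real.sqrt_pos.2 hσ).ne', one_smul]
  calc ‖P.K (PiLp.single 2 j v)‖ ^ 2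
      ≤ (‖A‖ * (√(S.σ j) * ‖v‖)) ^ 2 := by
        rw [hKA]
        gcongr
        refine (A.le_opNorm _).trans_eq ?_
        rw [PiLp.norm_single, norm_smul, Real.norm_of_nonneg (Real.sqrt_nonneg _)]
    _ = S.Lbar P * (S.σ j * ‖v‖ ^ 2) := by
        rw [mul_pow, mul_pow, Real.sq_sqrt hσ.le, Lbar]

end Admissible

end Params

/-! ### The objective on its effective domain, and Lagrange multipliers -/

section ERealSums

variable {ι : Type*} (s : Finset ι) {a : ι → EReal}

theorem sum_ne_bot (h : ∀ i ∈ s, a i ≠ ⊥) : ∑ i ∈ s, a i ≠ ⊥ := by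
  classical
  induction s using Finset.induction_on with
  | empty => simp
  | insert i s hi ih =>
    rw [Finset.sum_insert hi]
    exact EReal.add_ne_bot_iff.2 ⟨h i (by simp), ih fun l hl => h l (by simp [hl])⟩

theorem sum_lt_top_iff (h : ∀ i ∈ s, a i ≠ ⊥) : ∑ i ∈ s, a i < ⊤ ↔ ∀ i ∈ s, a i < ⊤ := by
  classical
  induction s using Finset.induction_on with
  | empty => simp
  | insert i s hi ih =>
    have hs : ∀ l ∈ s, a l ≠ ⊥ := fun l hl => h l (by simp [hl])
    rw [Finset.sum_insert hi, lt_top_iff_ne_top,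
      EReal.add_ne_top_iff_ne_top₂ (h i (by simp)) (sum_ne_bot s hs), ← lt_top_iff_ne_top,
      ← lt_top_iff_ne_top, ih hs, Finset.forall_mem_insert]

theorem sum_eq_coe_sum_toReal (h : ∀ i ∈ s, a i ≠ ⊥) (h' : ∀ i ∈ s, a i < ⊤) :
    ∑ i ∈ s, a i = ((∑ i ∈ s, (a i).toReal : ℝ) : EReal) := by
  classical
  induction s using Finset.induction_on with
  | empty => simp
  | insert i s hi ih =>
    rw [Finset.sum_insert hi, Finset.sum_insert hi, EReal.coe_add,
      ih (fun l hl => h l (by simp [hl])) fun l hl => h' l (by simp [hl]),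
      EReal.coe_toReal (h' i (by simp)).ne (h i (by simp))]

end ERealSums

theorem conjugate_add_conjugate_le {E E' : Type*} [NormedAddCommGroup E] [InnerProductSpace ℝ E]
    [NormedAddCommGroup E'] [InnerProductSpace ℝ E'] {f : E → EReal} {f' : E' → EReal} {z : E}
    {z' : E'} {c : EReal}
    (h : ∀ x x', ((⟪z, x⟫ : ℝ) - f x : EReal) + ((⟪z', x'⟫ : ℝ) - f' x') ≤ c) :
    conjugate f z + conjugate f' z' ≤ c := by
  refine EReal.add_le_of_forall_lt fun a ha b hb => ?_
  obtain ⟨x, hx⟩ := lt_iSup_iff.1 ha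
  obtain ⟨x', hx'⟩ := lt_iSup_iff.1 hb
  exact (add_le_add hx.le hx'.le).trans (h x x')

namespace Problem

variable {n m : ℕ} (P : Problem n m)

/-- The domain of `x ↦ ∑ j, f_j (x_j)`. -/
def dom : Set (BlockSpace P.p) := {x | ∀ j, x j ∈ effDom (P.f j)}

/-- Real values of `∑ j, f_j (x_j)`, meaningful on `P.dom` only. -/
def fReal (x : BlockSpace P.p) : ℝ := ∑ j, (P.f j (x j)).toReal

/-- Real values of `∑ i, g_i (r_i)`, meaningful where all `g_i (r_i)` are finite. -/
def gReal (r : BlockSpace P.d) : ℝ := ∑ i, (P.g i (r i)).toReal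

/-- The Lagrangian of `min_{x, r} f(x) + h(x) + g(r)` subject to `K x = r`. -/
def lagrangian (y : BlockSpace P.d) (x : BlockSpace P.p) (r : BlockSpace P.d) : ℝ :=
  P.fReal x + P.h x + P.gReal r + ⟪y, P.K x - r⟫

/-- `y` is a Lagrange multiplier: the Lagrangian is bounded below by the optimal value. -/
def IsMultiplier (y : BlockSpace P.d) : Prop :=
  ∀ x ∈ P.dom, ∀ r, P.Fstar.toReal ≤ P.lagrangian y x r

variable {P}

theorem inner_neg_KT (y : BlockSpace P.d) (x : BlockSpace P.p) :
    ⟪-(P.KT y), x⟫ = -⟪y, P.K x⟫ := by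
  rw [inner_neg_left, KT, ContinuousLinearMap.adjoint_inner_left]

theorem Fstar_eq {xs : BlockSpace P.p} (hxs : xs ∈ P.primalSolutions) : P.Fstar = P.F xs :=
  le_antisymm (iInf_le _ xs) (le_iInf hxs)

namespace Assumption

variable {L : Fin n → ℝ} {M : ℝ≥0} {xs : BlockSpace P.p}

theorem h_add_single_le (hP : P.Assumption L) (x : BlockSpace P.p) (j : Fin n)
    (v : EuclideanSpace ℝ (Fin (P.p j))) :
    P.h (x + PiLp.single 2 j v) ≤ P.h x + ⟪(∇ P.h x) j, v⟫ + L j * ‖v‖ ^ 2 / 2 := by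
  have hdescent := le_add_inner_gradient_add_of_inner_gradient_sub_le hP.h_diff x
    (PiLp.single 2 j v) (C := L j * ‖v‖ ^ 2) fun t ht => ?_
  · rwa [inner_piLp_single_right] at hdescent
  · rw [inner_piLp_single_right, smul_piLp_single]
    refine (real_inner_le_norm _ _).trans ((mul_le_mul_of_nonneg_right
      (hP.h_smooth x j (t • v)) (norm_nonneg v)).trans_eq ?_)
    rw [norm_smul, Real.norm_of_nonneg ht.1.le]
    ring

theorem fSum_lt_top_iff (hP : P.Assumption L) {x : BlockSpace P.p} :
    P.fSum x < ⊤ ↔ x ∈ P.dom :=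
  (sum_lt_top_iff _ fun j _ => (hP.f_pcc j).ne_bot _).trans (by simp [dom, effDom])

theorem dom_nonempty (hP : P.Assumption L) : P.dom.Nonempty := by
  choose x hx using fun j => (hP.f_pcc j).dom_nonempty
  exact ⟨WithLp.toLp 2 x, hx⟩

theorem mem_effDom_g (hP : P.Assumption L) (hg : LipschitzExt M P.gSum) (i : Fin m)
    (u : EuclideanSpace ℝ (Fin (P.d i))) : u ∈ effDom (P.g i) := by
  choose y hy using fun i => (hP.g_pcc i).dom_nonempty
  have hfinite : ∀ z : BlockSpace P.d, P.gSum z < ⊤ ↔ ∀ i ∈ Finset.univ, P.g i (z i) < ⊤ :=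
    fun z => sum_lt_top_iff _ fun i _ => (hP.g_pcc i).ne_bot _
  have hu : P.gSum (setBlock (WithLp.toLp 2 y) i u) < ⊤ :=
    (hg _ (WithLp.toLp 2 y)).trans_lt
      (EReal.add_lt_top ((hfinite _).2 fun i _ => hy i).ne (EReal.coe_ne_top _))
  have := (hfinite _).1 hu i (Finset.mem_univ i)
  rwa [setBlock_apply_same] at this

theorem gSum_eq (hP : P.Assumption L) (hg : LipschitzExt M P.gSum) (r : BlockSpace P.d) :
    P.gSum r = P.gReal r :=
  sum_eq_coe_sum_toReal _ (fun i _ => (hP.g_pcc i).ne_bot _) fun i _ => hP.mem_effDom_g hg i _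

theorem phi_eq (hP : P.Assumption L) {x : BlockSpace P.p} (hx : x ∈ P.dom) :
    P.phi x = ((P.fReal x + P.h x : ℝ) : EReal) := by
  rw [phi, EReal.coe_add]
  exact congrArg (· + _)
    (sum_eq_coe_sum_toReal _ (fun j _ => (hP.f_pcc j).ne_bot _) fun j _ => hx j)

theorem phi_eq_top (hP : P.Assumption L) {x : BlockSpace P.p} (hx : x ∉ P.dom) :
    P.phi x = ⊤ := by
  rw [phi, not_lt_top_iff.1 (mt hP.fSum_lt_top_iff.1 hx), EReal.top_add_coe]

theorem F_eq (hP : P.Assumption L) (hg : LipschitzExt M P.gSum) {x : BlockSpace P.p}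
    (hx : x ∈ P.dom) : P.F x = ((P.fReal x + P.h x + P.gReal (P.K x) : ℝ) : EReal) := by
  rw [F, hP.phi_eq hx, hP.gSum_eq hg, ← EReal.coe_add]

theorem F_toReal (hP : P.Assumption L) (hg : LipschitzExt M P.gSum) {x : BlockSpace P.p}
    (hx : x ∈ P.dom) : (P.F x).toReal = P.fReal x + P.h x + P.gReal (P.K x) := by
  rw [hP.F_eq hg hx, EReal.toReal_coe]

theorem F_lt_top_iff (hP : P.Assumption L) (hg : LipschitzExt M P.gSum) {x : BlockSpace P.p} :
    P.F x < ⊤ ↔ x ∈ P.dom := by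
  refine ⟨fun h => ?_, fun h => hP.F_eq hg h ▸ EReal.coe_lt_top _⟩
  by_contra hx
  rw [F, hP.phi_eq_top hx, hP.gSum_eq hg, EReal.top_add_coe] at h
  exact lt_irrefl _ h

theorem mem_dom_of_primalSolutions (hP : P.Assumption L) (hg : LipschitzExt M P.gSum)
    (hxs : xs ∈ P.primalSolutions) : xs ∈ P.dom := by
  obtain ⟨x, hx⟩ := hP.dom_nonempty
  exact (hP.F_lt_top_iff hg).1 ((hxs x).trans_lt ((hP.F_lt_top_iff hg).2 hx))

theorem Fstar_toReal_eq (hP : P.Assumption L) (hg : LipschitzExt M P.gSum)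
    (hxs : xs ∈ P.primalSolutions) : P.Fstar.toReal = P.fReal xs + P.h xs + P.gReal (P.K xs) := by
  rw [Fstar_eq hxs, hP.F_toReal hg (hP.mem_dom_of_primalSolutions hg hxs)]

theorem Fstar_toReal_le (hP : P.Assumption L) (hg : LipschitzExt M P.gSum) {x : BlockSpace P.p}
    (hx : x ∈ P.dom) : P.Fstar.toReal ≤ P.fReal x + P.h x + P.gReal (P.K x) := by
  obtain ⟨xs, hxs⟩ := hP.solution
  have hle := hxs x
  rw [hP.F_eq hg hx, hP.F_eq hg (hP.mem_dom_of_primalSolutions hg hxs),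
    EReal.coe_le_coe_iff] at hle
  rwa [hP.Fstar_toReal_eq hg hxs]

theorem convexOn_fReal (hP : P.Assumption L) : ConvexOn ℝ P.dom P.fReal := by
  refine ⟨fun x hx y hy a b ha hb hab j => ?_, fun x hx y hy a b ha hb hab => ?_⟩
  · exact (hP.f_pcc j).convexOn_toReal.1 (hx j) (hy j) ha hb hab
  · simp only [fReal, smul_eq_mul, Finset.mul_sum, ← Finset.sum_add_distrib]
    exact Finset.sum_le_sum fun j _ =>
      (hP.f_pcc j).convexOn_toReal.2 (hx j) (hy j) ha hb hab

theorem convexOn_gReal (hP : P.Assumption L) (hg : LipschitzExt M P.gSum) :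
    ConvexOn ℝ Set.univ P.gReal := by
  refine ⟨convex_univ, fun x _ y _ a b ha hb hab => ?_⟩
  simp only [gReal, smul_eq_mul, Finset.mul_sum, ← Finset.sum_add_distrib]
  exact Finset.sum_le_sum fun i _ => (hP.g_pcc i).convexOn_toReal.2
    (hP.mem_effDom_g hg i (x i)) (hP.mem_effDom_g hg i (y i)) ha hb hab

theorem gReal_le (hP : P.Assumption L) (hg : LipschitzExt M P.gSum) (r s : BlockSpace P.d) :
    P.gReal r ≤ P.gReal s + M * ‖r - s‖ := by
  have h := hg r s
  rw [hP.gSum_eq hg, hP.gSum_eq hg] at h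
  exact_mod_cast h

theorem continuous_gReal (hP : P.Assumption L) (hg : LipschitzExt M P.gSum) :
    Continuous P.gReal :=
  (LipschitzWith.of_le_add_mul M fun r s => by
    rw [dist_eq_norm]
    exact hP.gReal_le hg r s).continuous

theorem exists_isMultiplier (hP : P.Assumption L) (hg : LipschitzExt M P.gSum) :
    ∃ y, P.IsMultiplier y := by
  obtain ⟨xs, hxs⟩ := hP.solution
  have hφ : ConvexOn ℝ P.dom fun x => P.fReal x + P.h x :=
    hP.convexOn_fReal.add (hP.h_convex.subset (Set.subset_univ _) hP.convexOn_fReal.1)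
  simp only [IsMultiplier, hP.Fstar_toReal_eq hg hxs]
  exact exists_saddle_multiplier P.K hφ (hP.convexOn_gReal hg) (hP.continuous_gReal hg)
    (hP.mem_dom_of_primalSolutions hg hxs)
    fun x hx => (hP.Fstar_toReal_eq hg hxs).symm.trans_le (hP.Fstar_toReal_le hg hx)

theorem inner_sub_phi_add_inner_sub_gSum (hP : P.Assumption L) (hg : LipschitzExt M P.gSum)
    {x : BlockSpace P.p} (hx : x ∈ P.dom) (r y : BlockSpace P.d) :
    (((⟪-(P.KT y), x⟫ : ℝ) : EReal) - P.phi x) + (((⟪y, r⟫ : ℝ) : EReal) - P.gSum r) =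
      ((-P.lagrangian y x r : ℝ) : EReal) := by
  rw [hP.phi_eq hx, hP.gSum_eq hg, inner_neg_KT, ← EReal.coe_sub, ← EReal.coe_sub,
    ← EReal.coe_add, lagrangian, inner_sub_right]
  congr 1
  ring

theorem neg_lagrangian_le_G (hP : P.Assumption L) (hg : LipschitzExt M P.gSum)
    {x : BlockSpace P.p} (hx : x ∈ P.dom) (r y : BlockSpace P.d) :
    ((-P.lagrangian y x r : ℝ) : EReal) ≤ P.G y := by
  rw [← hP.inner_sub_phi_add_inner_sub_gSum hg hx]
  exact add_le_add (le_iSup (fun x => ((⟪-(P.KT y), x⟫ : ℝ) : EReal) - P.phi x) x)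
    (le_iSup (fun r => ((⟪y, r⟫ : ℝ) : EReal) - P.gSum r) r)

theorem G_le_of_isMultiplier (hP : P.Assumption L) (hg : LipschitzExt M P.gSum)
    {y : BlockSpace P.d} (hy : P.IsMultiplier y) : P.G y ≤ ((-P.Fstar.toReal : ℝ) : EReal) := by
  refine conjugate_add_conjugate_le fun x r => ?_
  by_cases hx : x ∈ P.dom
  · rw [hP.inner_sub_phi_add_inner_sub_gSum hg hx]
    exact EReal.coe_le_coe_iff.2 (neg_le_neg (hy x hx r))
  · rw [hP.phi_eq_top hx, EReal.sub_top, EReal.bot_add]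
    exact bot_le

theorem isMultiplier_of_dualSolutions (hP : P.Assumption L) (hg : LipschitzExt M P.gSum)
    {ys : BlockSpace P.d} (hys : ys ∈ P.dualSolutions) : P.IsMultiplier ys := by
  obtain ⟨y, hy⟩ := hP.exists_isMultiplier hg
  intro x hx r
  exact neg_le_neg_iff.1 (EReal.coe_le_coe_iff.1
    ((hP.neg_lagrangian_le_G hg hx r ys).trans ((hys y).trans (hP.G_le_of_isMultiplier hg hy))))

end Assumption

end Problem

/-! ### One iteration of the algorithm -/

/-- The increase of the one-step model when a block is moved from `x` to `u`, with `s` the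
curvature of the block and `q` its sampling probability; `z` is the block of the reference point. -/
def blockChange {E : Type*} [NormedAddCommGroup E] [InnerProductSpace ℝ E] (τ τ₀ q s : ℝ)
    (f : E → EReal) (Δ x u z : E) : ℝ :=
  τ / τ₀ * ((f u).toReal - (f x).toReal + ⟪Δ, u - x⟫) + (τ / τ₀) ^ 2 * (s / 2) * ‖u - x‖ ^ 2
    + τ ^ 2 / (2 * τ₀) * (s / q) * (‖u - z‖ ^ 2 - ‖x - z‖ ^ 2)

theorem ProperClosedConvex.mul_blockChange_le {E : Type*} [NormedAddCommGroup E]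
    [InnerProductSpace ℝ E] [ProperSpace E] {f : E → EReal} (hf : ProperClosedConvex f)
    {τ τ₀ q s b : ℝ} (hτ : 0 < τ) (hτ₀ : 0 < τ₀) (hq : τ₀ ≤ q) (hs : 0 < s)
    (hb : b = τ₀ / (τ * s)) {Δ x z u : E} (hx : x ∈ effDom f) (hz : z ∈ effDom f)
    (hprox : forwardBackward f b Δ x = u) :
    q * blockChange τ τ₀ q s f Δ x u z ≤ τ * ((f z).toReal - (f x).toReal + ⟪Δ, z - x⟫) := by
  have hb0 : 0 < b := hb ▸ div_pos hτ₀ (mul_pos hτ hs)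
  have hq0 : 0 ≤ q / τ₀ - 1 := sub_nonneg.2 ((one_le_div hτ₀).2 hq)
  have hstep : 1 / (2 * b) = τ * s / (2 * τ₀) := by rw [hb]; field_simp
  have hinner : ⟪Δ, u - z⟫ = ⟪Δ, u - x⟫ - ⟪Δ, z - x⟫ := by
    rw [← inner_sub_right, sub_sub_sub_cancel_right]
  have htarget := hf.forwardBackward_three_point hb0 hz hprox
  have hdescent := hf.forwardBackward_three_point hb0 hx hprox
  rw [hstep, hinner] at htarget
  rw [hstep, sub_self, norm_zero] at hdescent
  have hslack : 0 ≤ τ ^ 2 * s / (2 * τ₀) * (q / τ₀ - 1) * ‖u - x‖ ^ 2 := by positivity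
  have hexpand : q * blockChange τ τ₀ q s f Δ x u z
      = q / τ₀ * (τ * ((f u).toReal - (f x).toReal + ⟪Δ, u - x⟫))
        + τ ^ 2 * s / (2 * τ₀) * (q / τ₀ * ‖u - x‖ ^ 2 + (‖u - z‖ ^ 2 - ‖x - z‖ ^ 2)) := by
    have : 0 < q := hτ₀.trans_le hq
    rw [blockChange]
    field_simp
    ring
  linear_combination hexpand + τ * htarget + τ * (q / τ₀ - 1) * hdescent + hslack

theorem multiplier_step_estimate {Y : Type*} [NormedAddCommGroup Y] [InnerProductSpace ℝ Y] {ρ : ℝ}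
    (hρ : 0 < ρ) (yh ys u û v : Y) :
    ⟪ys, u⟫ + ρ / 2 * ‖u‖ ^ 2 + 1 / ρ * ‖yh + (ρ / 2) • (u - v) - ys‖ ^ 2
      ≤ ⟪ys, v⟫ + ρ / 2 * ‖v‖ ^ 2 + 1 / ρ * ‖yh - ys‖ ^ 2
        + ⟪yh + ρ • û, u - v⟫ + ρ * ‖u - û‖ ^ 2 := by
  have hdual : 1 / ρ * ‖yh + (ρ / 2) • (u - v) - ys‖ ^ 2
      = 1 / ρ * ‖yh - ys‖ ^ 2 + ⟪yh - ys, u - v⟫ + ρ / 4 * ‖u - v‖ ^ 2 := by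
    rw [add_sub_right_comm, norm_add_sq_real, real_inner_smul_right, norm_smul, mul_pow,
      Real.norm_eq_abs, sq_abs]
    field_simp
    ring
  -- Both sides differ by `ρ / 4` times this square.
  have hsq : 0 ≤ ‖u - v - (2 : ℝ) • (u - û)‖ ^ 2 := sq_nonneg _
  have hv : ‖v‖ ^ 2 = ‖u‖ ^ 2 - 2 * ⟪u, u - v⟫ + ‖u - v‖ ^ 2 := by
    rw [← norm_sub_sq_real, sub_sub_cancel]
  have hû : ⟪û, u - v⟫ = ⟪u, u - v⟫ - ⟪u - v, u - û⟫ := by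
    rw [real_inner_comm (u - û), ← inner_sub_left, sub_sub_cancel]
  have hys : ⟪ys, u - v⟫ = ⟪ys, u⟫ - ⟪ys, v⟫ := inner_sub_right _ _ _
  rw [norm_sub_sq_real, norm_smul, mul_pow, real_inner_smul_right, Real.norm_ofNat] at hsq
  rw [hdual, hv, inner_add_left, real_inner_smul_left, hû, inner_sub_left, hys]
  linear_combination ρ / 4 * hsq

section OneStep

variable {n m : ℕ} {P : Problem n m}

namespace State

variable (S : Params n m) (k : ℕ) (s : State P)

/-- The extrapolated point `x̂ = (1 - τ) x + τ x̃`. -/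
def xh : BlockSpace P.p := (1 - S.τ k) • s.x + S.τ k • s.xt

/-- The extrapolated point `r̂ = (1 - τ) r + τ r̃`. -/
def rh : BlockSpace P.d := (1 - S.τ k) • s.r + S.τ k • s.rt

/-- The predicted multiplier `ŷ + ρ (K x̂ - r̂)`. -/
def ypred : BlockSpace P.d := s.yh + S.ρ k • (P.K (s.xh S k) - s.rh S k)

/-- The gradient `Δ̂_x` of the augmented Lagrangian in `x` at `(x̂, r̂, ŷ)`. -/
def gradX : BlockSpace P.p := ∇ P.h (s.xh S k) + P.KT (s.ypred S k)

/-- The gradient `Δ̂_r` of the augmented Lagrangian in `r` at `(x̂, r̂, ŷ)`. -/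
def gradR : BlockSpace P.d := -s.yh + S.ρ k • (s.rh S k - P.K (s.xh S k))

/-- The new value of block `j` of `x̃` if that block is sampled. -/
def proxX (j : Fin n) : EuclideanSpace ℝ (Fin (P.p j)) :=
  forwardBackward (P.f j) (S.τ₀ * S.β P k / (S.τ k * S.σ j)) (s.gradX S k j) (s.xt j)

/-- The new value of block `i` of `r̃` if that block is sampled. -/
def proxR (i : Fin m) : EuclideanSpace ℝ (Fin (P.d i)) :=
  forwardBackward (P.g i) (S.τ₀ * S.γ k / S.τ k) (s.gradR S k i) (s.rt i)

/-- The feasibility residual `K x - r`. -/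
def res : BlockSpace P.d := P.K s.x - s.r

theorem gradR_eq_neg_ypred : s.gradR S k = -s.ypred S k := by
  rw [gradR, ypred]
  module

end State

section Step

variable (S : Params n m) (k : ℕ) (i : Fin m) (j : Fin n) (s : State P)

theorem step_xt : (step P S k i j s).xt = setBlock s.xt j (s.proxX S k j) := rfl

theorem step_rt : (step P S k i j s).rt = setBlock s.rt i (s.proxR S k i) := rfl

theorem step_x :
    (step P S k i j s).x
      = s.xh S k + (S.τ k / S.τ₀) • PiLp.single 2 j (s.proxX S k j - s.xt j) := by
  rw [← setBlock_sub_self]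
  rfl

theorem step_r :
    (step P S k i j s).r
      = s.rh S k + (S.τ k / S.τ₀) • PiLp.single 2 i (s.proxR S k i - s.rt i) := by
  rw [← setBlock_sub_self]
  rfl

theorem step_yh :
    (step P S k i j s).yh
      = s.yh + (S.ρ k / 2) • ((step P S k i j s).res - (1 - S.τ k) • s.res) := rfl

theorem res_step_sub :
    (step P S k i j s).res - (P.K (s.xh S k) - s.rh S k)
      = (S.τ k / S.τ₀) • (P.K (PiLp.single 2 j (s.proxX S k j - s.xt j))
        - PiLp.single 2 i (s.proxR S k i - s.rt i)) := by
  rw [State.res, step_x, step_r, map_add, map_smul]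
  module

theorem extrapolated_res_sub :
    P.K (s.xh S k) - s.rh S k - (1 - S.τ k) • s.res = S.τ k • (P.K s.xt - s.rt) := by
  rw [State.xh, State.rh, State.res, map_add, map_smul, map_smul]
  module

theorem inner_ypred_res_step_sub :
    ⟪s.ypred S k, (step P S k i j s).res - (1 - S.τ k) • s.res⟫
      = S.τ k * ⟪s.ypred S k, P.K s.xt - s.rt⟫
        + S.τ k / S.τ₀ * (⟪P.KT (s.ypred S k) j, s.proxX S k j - s.xt j⟫
          + ⟪s.gradR S k i, s.proxR S k i - s.rt i⟫) := by
  rw [← sub_add_sub_cancel _ (P.K (s.xh S k) - s.rh S k), res_step_sub, extrapolated_res_sub,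
    inner_add_right, real_inner_smul_right, real_inner_smul_right, inner_sub_right (s.ypred S k),
    s.gradR_eq_neg_ypred, ← inner_piLp_single_right (P.KT _),
    ← inner_piLp_single_right (-s.ypred S k), inner_neg_left, Problem.KT,
    ContinuousLinearMap.adjoint_inner_left]
  ring

end Step

variable {S : Params n m}

theorem h_step_x_le (hP : P.Assumption S.L) (hS : S.Admissible) (k : ℕ) (i : Fin m) (j : Fin n)
    (s : State P) :
    P.h (step P S k i j s).x ≤ P.h (s.xh S k)
      + S.τ k / S.τ₀ * ⟪∇ P.h (s.xh S k) j, s.proxX S k j - s.xt j⟫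
      + (S.τ k / S.τ₀) ^ 2 * (S.Lhσ * S.σ j / 2) * ‖s.proxX S k j - s.xt j‖ ^ 2 := by
  rw [step_x, smul_piLp_single]
  refine (hP.h_add_single_le _ j _).trans ?_
  rw [real_inner_smul_right, norm_smul, mul_pow, Real.norm_eq_abs, sq_abs]
  have hL := mul_le_mul_of_nonneg_right (hS.L_le j)
    (by positivity : 0 ≤ (S.τ k / S.τ₀) ^ 2 * ‖s.proxX S k j - s.xt j‖ ^ 2 / 2)
  linarith

theorem norm_sq_res_step_sub_le (hS : S.Admissible) (k : ℕ) (i : Fin m) (j : Fin n)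
    (s : State P) :
    ‖(step P S k i j s).res - (P.K (s.xh S k) - s.rh S k)‖ ^ 2
      ≤ (S.τ k / S.τ₀) ^ 2 * (2 * (S.Lbar P * (S.σ j * ‖s.proxX S k j - s.xt j‖ ^ 2))
        + 2 * ‖s.proxR S k i - s.rt i‖ ^ 2) := by
  rw [res_step_sub, norm_smul, mul_pow, Real.norm_eq_abs, sq_abs]
  gcongr
  set Kdx := P.K (PiLp.single 2 j (s.proxX S k j - s.xt j))
  set dr : BlockSpace P.d := PiLp.single 2 i (s.proxR S k i - s.rt i)
  have hpar := parallelogram_law_with_norm ℝ Kdx dr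
  have hK : ‖Kdx‖ ^ 2 ≤ S.Lbar P * (S.σ j * ‖s.proxX S k j - s.xt j‖ ^ 2) :=
    hS.norm_sq_K_single_le j _
  have hnorm : ‖dr‖ = ‖s.proxR S k i - s.rt i‖ := PiLp.norm_single _ _ _ _
  rw [← hnorm]
  linarith [mul_self_nonneg ‖Kdx + dr‖, sq ‖Kdx - dr‖, sq ‖Kdx‖, sq ‖dr‖]

theorem proxX_mem_effDom (hP : P.Assumption S.L) (hS : S.Admissible)
    (hβ : 0 < S.Lhσ ∨ 0 < S.Lbar P) (k : ℕ) (j : Fin n) (s : State P) :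
    s.proxX S k j ∈ effDom (P.f j) :=
  (hP.f_pcc j).forwardBackward_mem_effDom
    (div_pos (mul_pos hS.τ₀_pos (one_div_pos.2 (hS.curvature_pos hP.L_nonneg hβ k)))
      (mul_pos (hS.τ_pos k) (hS.σ_pos j))) _ _

theorem step_xt_mem_dom (hP : P.Assumption S.L) (hS : S.Admissible)
    (hβ : 0 < S.Lhσ ∨ 0 < S.Lbar P) (k : ℕ) (i : Fin m) (j : Fin n) {s : State P}
    (hs : s.xt ∈ P.dom) : (step P S k i j s).xt ∈ P.dom := by
  intro l
  rw [step_xt]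
  rcases eq_or_ne l j with rfl | hl
  · rw [setBlock_apply_same]
    exact proxX_mem_effDom hP hS hβ k l s
  · rw [setBlock_apply_of_ne _ _ _ hl]
    exact hs l

namespace State

variable (S) (xs : BlockSpace P.p) (k : ℕ) (s : State P)

/-- The model increase from resampling block `j` of `x̃`. -/
def changeX (j : Fin n) : ℝ :=
  blockChange (S.τ k) S.τ₀ (S.q j) (S.σ j * S.curvature P k) (P.f j) (s.gradX S k j) (s.xt j)
    (s.proxX S k j) (xs j)

/-- The model increase from resampling block `i` of `r̃`. -/
def changeR (i : Fin m) : ℝ :=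
  blockChange (S.τ k) S.τ₀ (S.qh i) (4 * S.ρ k) (P.g i) (s.gradR S k i) (s.rt i)
    (s.proxR S k i) (P.K xs i)

/-- The error of the linearization at the extrapolated point, before any block is moved. -/
def modelGap : ℝ :=
  P.h (s.xh S k) - (1 - S.τ k) * P.h s.x
    + S.τ k * (P.fReal s.xt + P.gReal s.rt + ⟪s.ypred S k, P.K s.xt - s.rt⟫ - P.Fstar.toReal)

variable {S} {xs}

theorem mul_changeX_le (hP : P.Assumption S.L) (hS : S.Admissible)
    (hβ : 0 < S.Lhσ ∨ 0 < S.Lbar P) (hxs : xs ∈ P.dom) (hs : s.xt ∈ P.dom) (j : Fin n) :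
    S.q j * s.changeX S xs k j ≤ S.τ k * ((P.f j (xs j)).toReal - (P.f j (s.xt j)).toReal
      + ⟪s.gradX S k j, xs j - s.xt j⟫) := by
  have hσ := hS.σ_pos j
  have hcurv := hS.curvature_pos hP.L_nonneg hβ k
  refine (hP.f_pcc j).mul_blockChange_le (hS.τ_pos k) hS.τ₀_pos (S.τ₀_le_q j) (mul_pos hσ hcurv)
    ?_ (hs j) (hxs j) rfl
  rw [Params.β, ← Params.curvature]
  field_simp

theorem mul_changeR_le (hP : P.Assumption S.L) (hS : S.Admissible) {M : ℝ≥0}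
    (hg : LipschitzExt M P.gSum) (i : Fin m) :
    S.qh i * s.changeR S xs k i ≤ S.τ k * ((P.g i (P.K xs i)).toReal - (P.g i (s.rt i)).toReal
      + ⟪s.gradR S k i, P.K xs i - s.rt i⟫) := by
  refine (hP.g_pcc i).mul_blockChange_le (hS.τ_pos k) hS.τ₀_pos (S.τ₀_le_qh i)
    (mul_pos four_pos (hS.ρ_pos k)) ?_ (hP.mem_effDom_g hg i _) (hP.mem_effDom_g hg i _) rfl
  rw [Params.γ]
  field_simp

theorem h_xh_add_inner_le (hP : P.Assumption S.L) (hS : S.Admissible) :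
    P.h (s.xh S k) + S.τ k * ⟪∇ P.h (s.xh S k), xs - s.xt⟫
      ≤ (1 - S.τ k) * P.h s.x + S.τ k * P.h xs := by
  have hsplit : S.τ k • (xs - s.xt)
      = (1 - S.τ k) • (s.x - s.xh S k) + S.τ k • (xs - s.xh S k) := by
    rw [xh]
    module
  rw [← real_inner_smul_right, hsplit, inner_add_right, real_inner_smul_right,
    real_inner_smul_right]
  have hx := mul_le_mul_of_nonneg_left
    (add_inner_gradient_le_of_convexOn hP.h_convex (hP.h_diff (s.xh S k)) s.x)
    (sub_nonneg.2 (hS.τ_le_one k))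
  have hxs := mul_le_mul_of_nonneg_left
    (add_inner_gradient_le_of_convexOn hP.h_convex (hP.h_diff (s.xh S k)) xs) (hS.τ_pos k).le
  linarith

theorem inner_gradX_add_inner_gradR :
    ⟪s.gradX S k, xs - s.xt⟫ + ⟪s.gradR S k, P.K xs - s.rt⟫
      = ⟪∇ P.h (s.xh S k), xs - s.xt⟫ - ⟪s.ypred S k, P.K s.xt - s.rt⟫ := by
  rw [gradX, gradR_eq_neg_ypred, inner_add_left, inner_neg_left, Problem.KT,
    ContinuousLinearMap.adjoint_inner_left, map_sub, inner_sub_right _ (P.K xs),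
    inner_sub_right _ (P.K xs), inner_sub_right _ (P.K s.xt)]
  ring

theorem modelGap_add_sum_add_sum_le (hP : P.Assumption S.L) (hS : S.Admissible) {M : ℝ≥0}
    (hg : LipschitzExt M P.gSum) (hxs : xs ∈ P.primalSolutions) :
    s.modelGap S k
      + ∑ j, S.τ k * ((P.f j (xs j)).toReal - (P.f j (s.xt j)).toReal
          + ⟪s.gradX S k j, xs j - s.xt j⟫)
      + ∑ i, S.τ k * ((P.g i (P.K xs i)).toReal - (P.g i (s.rt i)).toReal
          + ⟪s.gradR S k i, P.K xs i - s.rt i⟫) ≤ 0 := by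
  have hsumX : ∑ j, S.τ k * ((P.f j (xs j)).toReal - (P.f j (s.xt j)).toReal
      + ⟪s.gradX S k j, xs j - s.xt j⟫)
      = S.τ k * (P.fReal xs - P.fReal s.xt + ⟪s.gradX S k, xs - s.xt⟫) := by
    rw [← Finset.mul_sum, Finset.sum_add_distrib, Finset.sum_sub_distrib, PiLp.inner_apply]
    rfl
  have hsumR : ∑ i, S.τ k * ((P.g i (P.K xs i)).toReal - (P.g i (s.rt i)).toReal
      + ⟪s.gradR S k i, P.K xs i - s.rt i⟫)
      = S.τ k * (P.gReal (P.K xs) - P.gReal s.rt + ⟪s.gradR S k, P.K xs - s.rt⟫) := by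
    rw [← Finset.mul_sum, Finset.sum_add_distrib, Finset.sum_sub_distrib, PiLp.inner_apply]
    rfl
  have hconvex := s.h_xh_add_inner_le (xs := xs) k hP hS
  have hinner := s.inner_gradX_add_inner_gradR (S := S) (xs := xs) k
  rw [hsumX, hsumR, modelGap, hP.Fstar_toReal_eq hg hxs]
  linear_combination hconvex + S.τ k * hinner

end State

/-- A state together with an upper bound for `f(x) + g(r)`. -/
structure BoundedState (P : Problem n m) extends State P where
  bound : ℝ

namespace BoundedState

/-- The initial state, with the exact value `f(x⁰) + g(K x⁰)`. -/
def init (x0 : BlockSpace P.p) (y0 : BlockSpace P.d) : BoundedState P where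
  toState := initState P x0 y0
  bound := P.fReal x0 + P.gReal (P.K x0)

/-- One iteration with sampled indices `(i, j)`. The bound is averaged with the same weights as
`x` and `r`, which are convex combinations of past values of `x̃` and `r̃`. -/
def next (S : Params n m) (k : ℕ) (ij : Fin m × Fin n) (a : BoundedState P) : BoundedState P where
  toState := step P S k ij.1 ij.2 a.toState
  bound := (1 - S.τ k) * a.bound + S.τ k * (P.fReal a.xt + P.gReal a.rt)
    + S.τ k / S.τ₀ * (P.fReal (step P S k ij.1 ij.2 a.toState).xt
      + P.gReal (step P S k ij.1 ij.2 a.toState).rt - (P.fReal a.xt + P.gReal a.rt))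

/-- The Lagrangian gap, with the recorded bound in place of `f(x) + g(r)`. -/
def lagGap (ys : BlockSpace P.d) (a : BoundedState P) : ℝ :=
  a.bound + P.h a.x - P.Fstar.toReal + ⟪ys, a.res⟫

/-- The distance of `(x̃, r̃)` to `(x⋆, K x⋆)`, in the metric of the proximal steps. -/
def proxDist (S : Params n m) (xs : BlockSpace P.p) (k : ℕ) (a : BoundedState P) : ℝ :=
  S.τ k / (2 * S.τ₀) * (S.curvature P k * wNormSq (fun j => S.σ j / S.q j) (a.xt - xs)
    + 4 * S.ρ k * wNormSq (fun i => 1 / S.qh i) (a.rt - P.K xs))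

/-- The potential of iteration `k`, in which the Lagrangian gap has weight `w`. -/
def potential (S : Params n m) (xs : BlockSpace P.p) (ys : BlockSpace P.d) (w : ℝ) (k : ℕ)
    (a : BoundedState P) : ℝ :=
  w * a.lagGap ys + w ^ 2 * (S.ρ₀ * S.τ₀ / 2) * ‖a.res‖ ^ 2
    + 1 / (S.ρ₀ * S.τ₀) * ‖a.yh - ys‖ ^ 2 + a.proxDist S xs k

variable (xs : BlockSpace P.p) (ys : BlockSpace P.d) (k : ℕ) (a : BoundedState P)

theorem lagGap_next (i : Fin m) (j : Fin n) :
    (a.next S k (i, j)).lagGap ys = (1 - S.τ k) * a.bound + S.τ k * (P.fReal a.xt + P.gReal a.rt)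
      + S.τ k / S.τ₀ * ((P.f j (a.proxX S k j)).toReal - (P.f j (a.xt j)).toReal
        + ((P.g i (a.proxR S k i)).toReal - (P.g i (a.rt i)).toReal))
      + P.h (a.next S k (i, j)).x - P.Fstar.toReal + ⟪ys, (a.next S k (i, j)).res⟫ := by
  have hf : P.fReal (step P S k i j a.toState).xt
      = P.fReal a.xt + ((P.f j (a.proxX S k j)).toReal - (P.f j (a.xt j)).toReal) :=
    sum_setBlock a.xt j _ fun l v => (P.f l v).toReal
  have hg : P.gReal (step P S k i j a.toState).rt
      = P.gReal a.rt + ((P.g i (a.proxR S k i)).toReal - (P.g i (a.rt i)).toReal) :=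
    sum_setBlock a.rt i _ fun l v => (P.g l v).toReal
  rw [lagGap]
  simp only [next, hf, hg]
  ring

theorem proxDist_next (i : Fin m) (j : Fin n) :
    (a.next S k (i, j)).proxDist S xs k = a.proxDist S xs k
      + S.τ k / (2 * S.τ₀) * (S.σ j * S.curvature P k / S.q j
        * (‖a.proxX S k j - xs j‖ ^ 2 - ‖a.xt j - xs j‖ ^ 2))
      + S.τ k / (2 * S.τ₀) * (4 * S.ρ k / S.qh i
        * (‖a.proxR S k i - P.K xs i‖ ^ 2 - ‖a.rt i - P.K xs i‖ ^ 2)) := by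
  simp only [proxDist, next, step_xt, step_rt, wNormSq_setBlock_sub]
  ring

theorem mul_potential (hS : S.Admissible) (w : ℝ) :
    S.τ k * a.potential S xs ys (w / S.τ k) k
      = w * a.lagGap ys + w ^ 2 * (S.ρ k / 2) * ‖a.res‖ ^ 2 + 1 / S.ρ k * ‖a.yh - ys‖ ^ 2
        + S.τ k * a.proxDist S xs k := by
  have hτ := hS.τ_pos k
  have hτ₀ := hS.τ₀_pos
  have hρ₀ := hS.ρ₀_pos
  rw [potential, Params.ρ]
  field_simp

variable {xs}

theorem mul_potential_next_le (hP : P.Assumption S.L) (hS : S.Admissible) (i : Fin m)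
    (j : Fin n) :
    S.τ k * (a.next S k (i, j)).potential S xs ys (1 / S.τ k) k
      ≤ S.τ k * a.potential S xs ys ((1 - S.τ k) / S.τ k) k + a.modelGap S k + a.changeX S xs k j
        + a.changeR S xs k i := by
  have hsmooth := h_step_x_le hP hS k i j a.toState
  have hmult := multiplier_step_estimate (hS.ρ_pos k) a.yh ys (step P S k i j a.toState).res
    (P.K (a.xh S k) - a.rh S k) ((1 - S.τ k) • a.res)
  have hinner := inner_ypred_res_step_sub S k i j a.toState
  have hquad := mul_le_mul_of_nonneg_left (norm_sq_res_step_sub_le hS k i j a.toState)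
    (hS.ρ_pos k).le
  have hgrad : ⟪a.gradX S k j, a.proxX S k j - a.xt j⟫
      = ⟪∇ P.h (a.xh S k) j, a.proxX S k j - a.xt j⟫
        + ⟪P.KT (a.ypred S k) j, a.proxX S k j - a.xt j⟫ := by
    rw [State.gradX, PiLp.add_apply, inner_add_left]
  rw [← State.ypred, hinner, real_inner_smul_right, norm_smul, mul_pow, Real.norm_eq_abs, sq_abs,
    ← step_yh] at hmult
  rw [mul_potential _ _ _ _ hS, mul_potential _ _ _ _ hS, lagGap_next, proxDist_next, lagGap,
    State.modelGap, State.changeX, State.changeR, blockChange, blockChange, hgrad,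
    Params.curvature]
  simp only [next]
  linear_combination hsmooth + hmult + hquad

end BoundedState

end OneStep

/-! ### The Lyapunov function -/

namespace Params

variable {n m : ℕ} (S : Params n m)

/-- The weight of the Lagrangian gap in the Lyapunov function of iteration `k`. It equals
`1 / τ_{k-1}` for `k > 0`. -/
def weight (k : ℕ) : ℝ := (k + S.c - 1) / (S.c * S.τ₀)

/-- The amount by which the weight of the Lagrangian gap drops in expectation at each
iteration. -/
def decay : ℝ := 1 - 1 / (S.c * S.τ₀)

/-- The coefficient of `x̃^k` when `x^k` is written as a convex combination of
`x̃^0, …, x̃^k`. -/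
def mixWeight : ℕ → ℝ
  | 0 => 1
  | k + 1 => S.τ k / S.τ₀

variable {S}

variable (S) in
theorem one_div_τ (k : ℕ) : 1 / S.τ k = S.weight (k + 1) := by
  rw [weight, τ, one_div_div]
  push_cast
  ring

theorem decay_pos (hc : 1 < S.c * S.τ₀) : 0 < S.decay :=
  sub_pos.2 ((div_lt_one (one_pos.trans hc)).2 hc)

namespace Admissible

theorem τ_zero (hS : S.Admissible) : S.τ 0 = S.τ₀ := by
  rw [τ, Nat.cast_zero, zero_add, mul_div_cancel_left₀ _ hS.c_pos.ne']

theorem τ_succ_le (hS : S.Admissible) (k : ℕ) : S.τ (k + 1) ≤ S.τ k := by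
  have := mul_pos hS.c_pos hS.τ₀_pos
  have := hS.add_c_pos k
  rw [τ, τ]
  gcongr
  exact k.le_succ

theorem τ_mul_ρ (hS : S.Admissible) (k : ℕ) : S.τ k * S.ρ k = S.ρ₀ * S.τ₀ :=
  mul_div_cancel₀ _ (hS.τ_pos k).ne'

theorem τ_mul_curvature (hS : S.Admissible) (P : Problem n m) (k : ℕ) :
    S.τ k * S.curvature P k = S.τ k * S.Lhσ + 4 * S.Lbar P * (S.ρ₀ * S.τ₀) := by
  rw [curvature, ← hS.τ_mul_ρ k]
  ring

theorem add_c_sub_one_pos (hS : S.Admissible) (k : ℕ) : 0 < k + S.c - 1 := by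
  linarith [hS.one_lt_c, k.cast_nonneg (α := ℝ)]

theorem weight_pos (hS : S.Admissible) (k : ℕ) : 0 < S.weight k :=
  div_pos (hS.add_c_sub_one_pos k) (mul_pos hS.c_pos hS.τ₀_pos)

theorem one_sub_τ_div_τ (hS : S.Admissible) (k : ℕ) :
    (1 - S.τ k) / S.τ k = S.weight k - S.decay := by
  rw [sub_div, div_self (hS.τ_pos k).ne', S.one_div_τ, weight, weight, decay]
  push_cast
  ring

theorem decay_le_weight (hS : S.Admissible) (k : ℕ) : S.decay ≤ S.weight k := by
  rw [← sub_nonneg, ← hS.one_sub_τ_div_τ]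
  exact div_nonneg (sub_nonneg.2 (hS.τ_le_one k)) (hS.τ_pos k).le

theorem mixWeight_nonneg (hS : S.Admissible) : ∀ k, 0 ≤ S.mixWeight k
  | 0 => zero_le_one
  | k + 1 => (div_pos (hS.τ_pos k) hS.τ₀_pos).le

theorem mixWeight_le_one (hS : S.Admissible) : ∀ k, S.mixWeight k ≤ 1
  | 0 => le_rfl
  | k + 1 => (div_le_one hS.τ₀_pos).2 (hS.τ_le_τ₀ k)

theorem mixWeight_succ_le (hS : S.Admissible) (k : ℕ) :
    S.mixWeight (k + 1) ≤ (1 - S.τ k) * S.mixWeight k + S.τ k := by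
  cases k with
  | zero =>
    rw [mixWeight, mixWeight, hS.τ_zero, div_self hS.τ₀_pos.ne', mul_one, sub_add_cancel]
  | succ k =>
    have hτ₀ := hS.τ₀_pos
    have hc := hS.c_pos
    have := hS.add_c_pos k
    have : (0 : ℝ) < k + 1 + S.c := by linarith
    have hslack : (1 - S.τ (k + 1)) * (S.τ k / S.τ₀) + S.τ (k + 1) - S.τ (k + 1) / S.τ₀
        = S.c * (1 + S.τ₀ * k) / ((k + S.c) * (k + 1 + S.c)) := by
      rw [τ, τ]
      push_cast
      field_simp
      ring
    rw [mixWeight, mixWeight, ← sub_nonneg, hslack]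
    positivity

theorem sum_sum_weights (hS : S.Admissible) (B : ℝ) (a : Fin n → ℝ) (b : Fin m → ℝ) :
    ∑ i, ∑ j, S.qh i * S.q j * (B + a j + b i)
      = B + ∑ j, S.q j * a j + ∑ i, S.qh i * b i := by
  have hinner : ∀ i, ∑ j, S.qh i * S.q j * (B + a j + b i)
      = S.qh i * (B + ∑ j, S.q j * a j) + S.qh i * b i := fun i => by
    simp only [mul_assoc, ← Finset.mul_sum, mul_add, Finset.sum_add_distrib, ← Finset.sum_mul,
      hS.q_sum, one_mul]
  simp only [hinner, Finset.sum_add_distrib, ← Finset.sum_mul, hS.qh_sum, one_mul]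

end Admissible

end Params

namespace BoundedState

variable {n m : ℕ} {P : Problem n m} {S : Params n m} {xs : BlockSpace P.p} {M : ℝ≥0}

section Expected

variable (ys : BlockSpace P.d) (k : ℕ)

theorem sum_potential_next_le {a : BoundedState P} (hP : P.Assumption S.L) (hS : S.Admissible)
    (hβ : 0 < S.Lhσ ∨ 0 < S.Lbar P) (hg : LipschitzExt M P.gSum)
    (hxs : xs ∈ P.primalSolutions) (ha : a.xt ∈ P.dom) :
    ∑ i, ∑ j, S.qh i * S.q j * (a.next S k (i, j)).potential S xs ys (1 / S.τ k) k
      ≤ a.potential S xs ys ((1 - S.τ k) / S.τ k) k := by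
  refine le_of_mul_le_mul_left ?_ (hS.τ_pos k)
  calc S.τ k * ∑ i, ∑ j, S.qh i * S.q j * (a.next S k (i, j)).potential S xs ys (1 / S.τ k) k
      = ∑ i, ∑ j, S.qh i * S.q j
          * (S.τ k * (a.next S k (i, j)).potential S xs ys (1 / S.τ k) k) := by
        simp only [Finset.mul_sum, mul_left_comm (S.τ k)]
    _ ≤ ∑ i, ∑ j, S.qh i * S.q j
          * (S.τ k * a.potential S xs ys ((1 - S.τ k) / S.τ k) k + a.modelGap S k
            + a.changeX S xs k j + a.changeR S xs k i) :=
        Finset.sum_le_sum fun i _ => Finset.sum_le_sum fun j _ => mul_le_mul_of_nonneg_left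
          (mul_potential_next_le ys k a hP hS i j) (mul_pos (hS.qh_pos i) (hS.q_pos j)).le
    _ = S.τ k * a.potential S xs ys ((1 - S.τ k) / S.τ k) k
          + (a.modelGap S k + ∑ j, S.q j * a.changeX S xs k j
            + ∑ i, S.qh i * a.changeR S xs k i) := by
        rw [hS.sum_sum_weights]
        ring
    _ ≤ S.τ k * a.potential S xs ys ((1 - S.τ k) / S.τ k) k := by
        refine add_le_of_nonpos_right (le_trans ?_ (a.modelGap_add_sum_add_sum_le k hP hS hg hxs))
        exact add_le_add (add_le_add_right (Finset.sum_le_sum fun j _ => a.mul_changeX_le k hP hS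
          hβ (hP.mem_dom_of_primalSolutions hg hxs) ha j) _)
          (Finset.sum_le_sum fun i _ => a.mul_changeR_le k hP hS hg i)

end Expected

variable (S)

/-- The Lagrangian gap with a quadratic penalty, in proportion to `weight k`, on the residual. -/
def augLagGap (ys : BlockSpace P.d) (k : ℕ) (a : BoundedState P) : ℝ :=
  a.lagGap ys + S.weight k * (S.ρ₀ * S.τ₀ / 2) * ‖a.res‖ ^ 2

variable (xs)

/-- The Lyapunov function of iteration `k`. -/
def lyapunov (ys : BlockSpace P.d) (k : ℕ) (a : BoundedState P) : ℝ :=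
  a.potential S xs ys (S.weight k) k

variable {S} (ys : BlockSpace P.d) (k : ℕ) (a : BoundedState P)

theorem proxDist_succ_le (hS : S.Admissible) (hL : ∀ j, 0 ≤ S.L j) :
    a.proxDist S xs (k + 1) ≤ a.proxDist S xs k := by
  have hdist : ∀ l, a.proxDist S xs l
      = 1 / (2 * S.τ₀) * (S.τ l * S.curvature P l * wNormSq (fun j => S.σ j / S.q j) (a.xt - xs)
        + 4 * (S.τ l * S.ρ l) * wNormSq (fun i => 1 / S.qh i) (a.rt - P.K xs)) := fun l => by
    rw [proxDist]
    ring
  have hτ₀ := hS.τ₀_pos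
  have hLhσ := hS.Lhσ_nonneg hL
  have hσ : 0 ≤ wNormSq (fun j => S.σ j / S.q j) (a.xt - xs) :=
    wNormSq_nonneg (fun j => (div_pos (hS.σ_pos j) (hS.q_pos j)).le) _
  rw [hdist, hdist, hS.τ_mul_curvature, hS.τ_mul_curvature, hS.τ_mul_ρ, hS.τ_mul_ρ]
  gcongr
  exact hS.τ_succ_le k

theorem proxDist_nonneg (hS : S.Admissible) (hL : ∀ j, 0 ≤ S.L j) : 0 ≤ a.proxDist S xs k :=
  mul_nonneg (div_nonneg (hS.τ_pos k).le (mul_nonneg zero_le_two hS.τ₀_pos.le)) (add_nonneg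
    (mul_nonneg (hS.curvature_nonneg hL k)
      (wNormSq_nonneg (fun j => (div_pos (hS.σ_pos j) (hS.q_pos j)).le) _))
    (mul_nonneg (mul_pos four_pos (hS.ρ_pos k)).le
      (wNormSq_nonneg (fun i => (one_div_pos.2 (hS.qh_pos i)).le) _)))

theorem weight_mul_augLagGap_le (hS : S.Admissible) (hL : ∀ j, 0 ≤ S.L j) :
    S.weight k * a.augLagGap S ys k ≤ a.lyapunov S xs ys k := by
  have hdual : 0 ≤ 1 / (S.ρ₀ * S.τ₀) * ‖a.yh - ys‖ ^ 2 :=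
    mul_nonneg (one_div_pos.2 (mul_pos hS.ρ₀_pos hS.τ₀_pos)).le (sq_nonneg _)
  have hdist := a.proxDist_nonneg xs k hS hL
  rw [lyapunov, potential, augLagGap]
  linarith

theorem potential_weight_sub_decay_le (hS : S.Admissible) (hc : 1 < S.c * S.τ₀) :
    a.potential S xs ys (S.weight k - S.decay) k + S.decay * a.augLagGap S ys k
      ≤ a.lyapunov S xs ys k := by
  have hρ₀ := hS.ρ₀_pos
  have hτ₀ := hS.τ₀_pos
  have hδ := Params.decay_pos hc
  have hδw := sub_nonneg.2 (hS.decay_le_weight k)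
  have hslack : 0 ≤ S.decay * (S.weight k - S.decay) * (S.ρ₀ * S.τ₀ / 2) * ‖a.res‖ ^ 2 := by
    positivity
  rw [lyapunov, potential, potential, augLagGap]
  linear_combination hslack

theorem sum_lyapunov_next_add_le (hP : P.Assumption S.L) (hS : S.Admissible)
    (hβ : 0 < S.Lhσ ∨ 0 < S.Lbar P) (hc : 1 < S.c * S.τ₀) (hg : LipschitzExt M P.gSum)
    {xs : BlockSpace P.p} (hxs : xs ∈ P.primalSolutions) (ha : a.xt ∈ P.dom) :
    ∑ i, ∑ j, S.qh i * S.q j * (a.next S k (i, j)).lyapunov S xs ys (k + 1)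
        + S.decay * a.augLagGap S ys k
      ≤ a.lyapunov S xs ys k := by
  have hmono : ∀ i j, (a.next S k (i, j)).lyapunov S xs ys (k + 1)
      ≤ (a.next S k (i, j)).potential S xs ys (1 / S.τ k) k := fun i j => by
    rw [lyapunov, S.one_div_τ]
    exact add_le_add_right (proxDist_succ_le xs k _ hS hP.L_nonneg) _
  refine le_trans (add_le_add_left ?_ _) (a.potential_weight_sub_decay_le xs ys k hS hc)
  rw [← hS.one_sub_τ_div_τ]
  refine le_trans ?_ (sum_potential_next_le ys k hP hS hβ hg hxs ha)
  exact Finset.sum_le_sum fun i _ => Finset.sum_le_sum fun j _ =>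
    mul_le_mul_of_nonneg_left (hmono i j) (mul_pos (hS.qh_pos i) (hS.q_pos j)).le

theorem res_init (x0 : BlockSpace P.p) (y0 : BlockSpace P.d) : (init x0 y0).res = 0 :=
  sub_self (P.K x0)

theorem lagGap_init (hP : P.Assumption S.L) (hg : LipschitzExt M P.gSum) {x0 : BlockSpace P.p}
    (hx0 : x0 ∈ P.dom) (y0 : BlockSpace P.d) :
    (init x0 y0).lagGap ys = (P.F x0 - P.Fstar).toReal := by
  obtain ⟨z, hz⟩ := hP.solution
  have hzdom := hP.mem_dom_of_primalSolutions hg hz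
  rw [lagGap, res_init, inner_zero_right, hP.Fstar_toReal_eq hg hz, Problem.Fstar_eq hz,
    hP.F_eq hg hx0, hP.F_eq hg hzdom, ← EReal.coe_sub, EReal.toReal_coe]
  simp only [init, initState]
  ring

theorem lyapunov_init_le (hP : P.Assumption S.L) (hS : S.Admissible)
    (hg : LipschitzExt M P.gSum) {x0 : BlockSpace P.p} (hx0 : x0 ∈ P.dom) (y0 : BlockSpace P.d) :
    (init x0 y0).lyapunov S xs ys 0 ≤ E0sq P S x0 y0 xs ys / S.τ₀ := by
  have hτ₀ := hS.τ₀_pos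
  have hρ₀ := hS.ρ₀_pos
  have hρ : S.ρ 0 = S.ρ₀ := by rw [Params.ρ, hS.τ_zero, mul_div_cancel_right₀ _ hτ₀.ne']
  have hgap0 : 0 ≤ (P.F x0 - P.Fstar).toReal :=
    EReal.toReal_nonneg ((EReal.sub_nonneg (.inl ((hP.F_lt_top_iff hg).2 hx0).ne)
      (.inl (hP.F_eq hg hx0 ▸ EReal.coe_ne_bot _))).2 (iInf_le _ _))
  have hweight : S.weight 0 * S.τ₀ ≤ 1 := by
    rw [Params.weight, Nat.cast_zero, zero_add, div_mul_eq_mul_div,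
      mul_div_mul_right _ _ hτ₀.ne', div_le_one hS.c_pos]
    exact sub_le_self _ zero_le_one
  have hmul := mul_le_mul_of_nonneg_left hweight hgap0
  have hyh : (init x0 y0).yh = y0 := rfl
  have hxt : (init x0 y0).xt = x0 := rfl
  have hrt : (init x0 y0).rt = P.K x0 := rfl
  rw [lyapunov, potential, proxDist, E0sq, lagGap_init ys hP hg hx0, res_init, norm_zero,
    hS.τ_zero, Params.curvature, hρ, hyh, hxt, hrt, ← map_sub, le_div_iff₀ hτ₀]
  field_simp
  linear_combination 2 * S.ρ₀ * hmul

end BoundedState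

/-! ### Expectations along the random iterates -/

namespace BoundedState

variable {n m : ℕ} {P : Problem n m} {M : ℝ≥0} {a : BoundedState P}

/-- A state with `x ∈ dom f` whose recorded bound is valid. -/
structure IsFeasible (a : BoundedState P) : Prop where
  x_mem_dom : a.x ∈ P.dom
  add_le_bound : P.fReal a.x + P.gReal a.r ≤ a.bound

theorem IsFeasible.lagGap_nonneg (ha : a.IsFeasible) {ys : BlockSpace P.d}
    (hys : P.IsMultiplier ys) : 0 ≤ a.lagGap ys := by
  have hgap := hys a.x ha.x_mem_dom a.r
  have hbound := ha.add_le_bound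
  rw [Problem.lagrangian] at hgap
  rw [lagGap, State.res]
  linarith

theorem IsFeasible.F_sub_le (ha : a.IsFeasible) {L : Fin n → ℝ} (hP : P.Assumption L)
    (hg : LipschitzExt M P.gSum)
    (ys : BlockSpace P.d) :
    (P.F a.x).toReal - P.Fstar.toReal ≤ a.lagGap ys + (M + ‖ys‖) * ‖a.res‖ := by
  have hlip : P.gReal (P.K a.x) ≤ P.gReal a.r + M * ‖a.res‖ := hP.gReal_le hg _ _
  have hinner := neg_le_of_abs_le (abs_real_inner_le_norm ys a.res)
  have hbound := ha.add_le_bound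
  rw [hP.F_toReal hg ha.x_mem_dom, lagGap]
  linarith

end BoundedState

section Trajectory

variable {n m : ℕ} {P : Problem n m} (S : Params n m) (x0 : BlockSpace P.p) (y0 : BlockSpace P.d)
  {Ω : Type*} (is : ℕ → Ω → Fin m) (js : ℕ → Ω → Fin n)

/-- The random iterates of the algorithm, with their bounds for `f(x^k) + g(r^k)`. -/
def trajectory (k : ℕ) (ω : Ω) : BoundedState P :=
  orbit (BoundedState.next S) (BoundedState.init x0 y0) (fun l => (is l ω, js l ω)) k

theorem trajectory_toState (k : ℕ) (ω : Ω) :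
    (trajectory S x0 y0 is js k ω).toState
      = iterate P S x0 y0 (fun l => is l ω) (fun l => js l ω) k := by
  induction k with
  | zero => rfl
  | succ k ih => exact congrArg (step P S k (is k ω) (js k ω)) ih

variable {S x0} {M : ℝ≥0}

theorem trajectory_xt_mem_dom (hP : P.Assumption S.L) (hS : S.Admissible)
    (hβ : 0 < S.Lhσ ∨ 0 < S.Lbar P) (hx0 : x0 ∈ P.dom) (k : ℕ) (ω : Ω) :
    (trajectory S x0 y0 is js k ω).xt ∈ P.dom := by
  induction k with
  | zero => exact hx0
  | succ k ih => exact step_xt_mem_dom hP hS hβ k (is k ω) (js k ω) ih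

theorem isFeasible_trajectory (hP : P.Assumption S.L) (hS : S.Admissible)
    (hβ : 0 < S.Lhσ ∨ 0 < S.Lbar P) (hg : LipschitzExt M P.gSum) (hx0 : x0 ∈ P.dom) (k : ℕ)
    (ω : Ω) : (trajectory S x0 y0 is js k ω).IsFeasible := by
  set a := fun k => trajectory S x0 y0 is js k ω
  have hf := hP.convexOn_fReal.comp_linearMap (LinearMap.fst ℝ _ (BlockSpace P.d))
  have hg := (hP.convexOn_gReal hg).comp_linearMap (LinearMap.snd ℝ (BlockSpace P.p) _)
  have hsum := hf.add (hg.subset (Set.subset_univ _) hf.1)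
  have hmem := averaged_mem_of_convex hsum.convex_epigraph hS.τ_le_one rfl hS.mixWeight_nonneg
    hS.mixWeight_le_one hS.mixWeight_succ_le
    (X := fun k => (((a k).x, (a k).r), (a k).bound))
    (Z := fun k => (((a k).xt, (a k).rt), P.fReal (a k).xt + P.gReal (a k).rt))
    (fun k => ⟨trajectory_xt_mem_dom y0 is js hP hS hβ hx0 k ω, le_rfl⟩) rfl
    (fun k => rfl) k
  exact ⟨hmem.1, hmem.2⟩

end Trajectory

section Mean

variable {n m : ℕ} {P : Problem n m} (S : Params n m) (x0 : BlockSpace P.p) (y0 : BlockSpace P.d)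
  {Ω : Type*} [MeasurableSpace Ω] (is : ℕ → Ω → Fin m) (js : ℕ → Ω → Fin n) (μ : Measure Ω)

/-- The expected augmented Lagrangian gap of the `k`-th iterate. -/
def meanAugLagGap (ys : BlockSpace P.d) (k : ℕ) : ℝ :=
  ∫ ω, (trajectory S x0 y0 is js k ω).augLagGap S ys k ∂μ

/-- The expected Lagrangian gap of the `k`-th iterate. -/
def meanLagGap (ys : BlockSpace P.d) (k : ℕ) : ℝ :=
  ∫ ω, (trajectory S x0 y0 is js k ω).lagGap ys ∂μ

/-- The expected residual norm `‖K x^k - r^k‖`. -/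
def meanRes (k : ℕ) : ℝ := ∫ ω, ‖(trajectory S x0 y0 is js k ω).res‖ ∂μ

variable {S x0 y0 is js μ} {M : ℝ≥0}

theorem integrable_trajectory [IsFiniteMeasure μ] (hsamp : Sampling S μ is js) (k : ℕ)
    (Φ : BoundedState P → ℝ) : Integrable (fun ω => Φ (trajectory S x0 y0 is js k ω)) μ :=
  integrable_orbit hsamp.measurable_prodMk _ _ Φ k

theorem meanLagGap_nonneg (hP : P.Assumption S.L) (hS : S.Admissible)
    (hβ : 0 < S.Lhσ ∨ 0 < S.Lbar P) (hg : LipschitzExt M P.gSum) (hx0 : x0 ∈ P.dom)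
    {ys : BlockSpace P.d} (hys : P.IsMultiplier ys) (k : ℕ) :
    0 ≤ meanLagGap S x0 y0 is js μ ys k :=
  integral_nonneg fun ω =>
    (isFeasible_trajectory y0 is js hP hS hβ hg hx0 k ω).lagGap_nonneg hys

theorem integral_F_sub_nonneg (hP : P.Assumption S.L) (hS : S.Admissible)
    (hβ : 0 < S.Lhσ ∨ 0 < S.Lbar P) (hg : LipschitzExt M P.gSum) (hx0 : x0 ∈ P.dom) (k : ℕ) :
    0 ≤ ∫ ω, ((P.F (trajectory S x0 y0 is js k ω).x).toReal - P.Fstar.toReal) ∂μ := by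
  refine integral_nonneg fun ω => sub_nonneg.2 ?_
  have hx := (isFeasible_trajectory y0 is js hP hS hβ hg hx0 k ω).x_mem_dom
  rw [hP.F_toReal hg hx]
  exact hP.Fstar_toReal_le hg hx

variable [IsProbabilityMeasure μ]

theorem integral_F_sub_le (hP : P.Assumption S.L) (hS : S.Admissible)
    (hβ : 0 < S.Lhσ ∨ 0 < S.Lbar P) (hg : LipschitzExt M P.gSum) (hx0 : x0 ∈ P.dom)
    (hsamp : Sampling S μ is js) (ys : BlockSpace P.d) (k : ℕ) :
    ∫ ω, ((P.F (trajectory S x0 y0 is js k ω).x).toReal - P.Fstar.toReal) ∂μ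
      ≤ meanLagGap S x0 y0 is js μ ys k + (M + ‖ys‖) * meanRes S x0 y0 is js μ k := by
  have hgap := integrable_trajectory (x0 := x0) (y0 := y0) hsamp k fun a => a.lagGap ys
  have hres := (integrable_trajectory (x0 := x0) (y0 := y0) hsamp k
    fun a => ‖a.res‖).const_mul (M + ‖ys‖)
  rw [meanLagGap, meanRes, ← integral_const_mul, ← integral_add hgap hres]
  exact integral_mono
    (integrable_trajectory hsamp k fun a => (P.F a.x).toReal - P.Fstar.toReal) (hgap.add hres)
    fun ω => (isFeasible_trajectory y0 is js hP hS hβ hg hx0 k ω).F_sub_le hP hg ys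

theorem meanLagGap_add_mul_sq_meanRes_le (hS : S.Admissible) (hsamp : Sampling S μ is js)
    (ys : BlockSpace P.d) (k : ℕ) :
    meanLagGap S x0 y0 is js μ ys k
        + S.weight k * (S.ρ₀ * S.τ₀ / 2) * meanRes S x0 y0 is js μ k ^ 2
      ≤ meanAugLagGap S x0 y0 is js μ ys k := by
  have hint := integrable_trajectory (x0 := x0) (y0 := y0) hsamp k
  have hjensen : meanRes S x0 y0 is js μ k ^ 2
      ≤ ∫ ω, ‖(trajectory S x0 y0 is js k ω).res‖ ^ 2 ∂μ :=
    even_two.convexOn_pow.map_integral_le (continuous_pow 2).continuousOn isClosed_univ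
      (Eventually.of_forall fun _ => Set.mem_univ _) (hint fun a => ‖a.res‖)
      (hint fun a => ‖a.res‖ ^ 2)
  have hcoeff := (mul_pos (hS.weight_pos k)
    (div_pos (mul_pos hS.ρ₀_pos hS.τ₀_pos) zero_lt_two)).le
  simp only [meanAugLagGap, BoundedState.augLagGap]
  rw [integral_add (hint fun a => a.lagGap ys) ((hint fun a => ‖a.res‖ ^ 2).const_mul _),
    integral_const_mul]
  exact add_le_add_right (mul_le_mul_of_nonneg_left hjensen hcoeff) _

theorem meanLagGap_le_meanAugLagGap (hS : S.Admissible) (hsamp : Sampling S μ is js)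
    (ys : BlockSpace P.d) (k : ℕ) :
    meanLagGap S x0 y0 is js μ ys k ≤ meanAugLagGap S x0 y0 is js μ ys k :=
  (le_add_of_nonneg_right (mul_nonneg (mul_pos (hS.weight_pos k)
    (div_pos (mul_pos hS.ρ₀_pos hS.τ₀_pos) zero_lt_two)).le (sq_nonneg _))).trans
    (meanLagGap_add_mul_sq_meanRes_le hS hsamp ys k)

theorem integral_lyapunov_succ_add_le (hP : P.Assumption S.L) (hS : S.Admissible)
    (hβ : 0 < S.Lhσ ∨ 0 < S.Lbar P) (hc : 1 < S.c * S.τ₀) (hg : LipschitzExt M P.gSum)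
    (hx0 : x0 ∈ P.dom) (hsamp : Sampling S μ is js) {xs : BlockSpace P.p}
    (hxs : xs ∈ P.primalSolutions) (ys : BlockSpace P.d) (k : ℕ) :
    ∫ ω, (trajectory S x0 y0 is js (k + 1) ω).lyapunov S xs ys (k + 1) ∂μ
        + S.decay * meanAugLagGap S x0 y0 is js μ ys k
      ≤ ∫ ω, (trajectory S x0 y0 is js k ω).lyapunov S xs ys k ∂μ := by
  have hint := integrable_trajectory (x0 := x0) (y0 := y0) hsamp k
  have hnext := hint fun a =>
    ∑ i, ∑ j, S.qh i * S.q j * (a.next S k (i, j)).lyapunov S xs ys (k + 1)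
  have hgap := (hint fun a => a.augLagGap S ys k).const_mul S.decay
  have hexp := hsamp.integral_orbit_succ (BoundedState.next S) (BoundedState.init x0 y0)
    (fun a => a.lyapunov S xs ys (k + 1)) k
  simp only [trajectory, meanAugLagGap] at hexp hnext hgap ⊢
  rw [hexp, ← integral_const_mul, ← integral_add hnext hgap]
  exact integral_mono (hnext.add hgap) (hint fun a => a.lyapunov S xs ys k) fun ω =>
    BoundedState.sum_lyapunov_next_add_le ys k _ hP hS hβ hc hg hxs
      (trajectory_xt_mem_dom y0 is js hP hS hβ hx0 k ω)

variable {xs : BlockSpace P.p} {ys : BlockSpace P.d}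

theorem meanAugLagGap_nonneg (hP : P.Assumption S.L) (hS : S.Admissible)
    (hβ : 0 < S.Lhσ ∨ 0 < S.Lbar P) (hg : LipschitzExt M P.gSum) (hx0 : x0 ∈ P.dom)
    (hsamp : Sampling S μ is js) (hys : P.IsMultiplier ys) (k : ℕ) :
    0 ≤ meanAugLagGap S x0 y0 is js μ ys k :=
  (meanLagGap_nonneg hP hS hβ hg hx0 hys k).trans (meanLagGap_le_meanAugLagGap hS hsamp ys k)

theorem weight_mul_meanAugLagGap_le_integral_lyapunov (hS : S.Admissible) (hL : ∀ j, 0 ≤ S.L j)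
    (hsamp : Sampling S μ is js) (k : ℕ) :
    S.weight k * meanAugLagGap S x0 y0 is js μ ys k
      ≤ ∫ ω, (trajectory S x0 y0 is js k ω).lyapunov S xs ys k ∂μ := by
  rw [meanAugLagGap, ← integral_const_mul]
  exact integral_mono ((integrable_trajectory hsamp k fun a => a.augLagGap S ys k).const_mul _)
    (integrable_trajectory hsamp k fun a => a.lyapunov S xs ys k)
    fun ω => BoundedState.weight_mul_augLagGap_le xs ys k _ hS hL

theorem integral_lyapunov_le (hP : P.Assumption S.L) (hS : S.Admissible)
    (hβ : 0 < S.Lhσ ∨ 0 < S.Lbar P) (hc : 1 < S.c * S.τ₀) (hg : LipschitzExt M P.gSum)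
    (hx0 : x0 ∈ P.dom) (hsamp : Sampling S μ is js) (hxs : xs ∈ P.primalSolutions)
    (hys : P.IsMultiplier ys) (k : ℕ) :
    ∫ ω, (trajectory S x0 y0 is js k ω).lyapunov S xs ys k ∂μ
      ≤ E0sq P S x0 y0 xs ys / S.τ₀ := by
  have hanti : Antitone fun k => ∫ ω, (trajectory S x0 y0 is js k ω).lyapunov S xs ys k ∂μ :=
    antitone_nat_of_succ_le fun k =>
      (le_add_of_nonneg_right (mul_nonneg (Params.decay_pos hc).le
        (meanAugLagGap_nonneg hP hS hβ hg hx0 hsamp hys k))).trans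
        (integral_lyapunov_succ_add_le hP hS hβ hc hg hx0 hsamp hxs ys k)
  refine (hanti k.zero_le).trans (le_trans (le_of_eq ?_)
    (BoundedState.lyapunov_init_le xs ys hP hS hg hx0 y0))
  simp only [trajectory, orbit, integral_const, probReal_univ, one_smul]

theorem mul_meanAugLagGap_le (hP : P.Assumption S.L) (hS : S.Admissible)
    (hβ : 0 < S.Lhσ ∨ 0 < S.Lbar P) (hc : 1 < S.c * S.τ₀) (hg : LipschitzExt M P.gSum)
    (hx0 : x0 ∈ P.dom) (hsamp : Sampling S μ is js) (hxs : xs ∈ P.primalSolutions)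
    (hys : P.IsMultiplier ys) (k : ℕ) :
    (k + S.c - 1) * meanAugLagGap S x0 y0 is js μ ys k ≤ S.c * E0sq P S x0 y0 xs ys := by
  have hτ₀ := hS.τ₀_pos
  have hcτ : 0 < S.c * S.τ₀ := one_pos.trans hc
  calc (k + S.c - 1) * meanAugLagGap S x0 y0 is js μ ys k
      = S.c * S.τ₀ * (S.weight k * meanAugLagGap S x0 y0 is js μ ys k) := by
        rw [← mul_assoc, Params.weight, mul_div_cancel₀ _ hcτ.ne']
    _ ≤ S.c * S.τ₀ * (E0sq P S x0 y0 xs ys / S.τ₀) := mul_le_mul_of_nonneg_left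
        ((weight_mul_meanAugLagGap_le_integral_lyapunov hS hP.L_nonneg hsamp k).trans
          (integral_lyapunov_le hP hS hβ hc hg hx0 hsamp hxs hys k)) hcτ.le
    _ = S.c * E0sq P S x0 y0 xs ys := by
        rw [mul_assoc, mul_div_cancel₀ _ hτ₀.ne']

theorem mul_meanLagGap_le (hP : P.Assumption S.L) (hS : S.Admissible)
    (hβ : 0 < S.Lhσ ∨ 0 < S.Lbar P) (hc : 1 < S.c * S.τ₀) (hg : LipschitzExt M P.gSum)
    (hx0 : x0 ∈ P.dom) (hsamp : Sampling S μ is js) (hxs : xs ∈ P.primalSolutions)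
    (hys : P.IsMultiplier ys) (k : ℕ) :
    (k + S.c - 1) * meanLagGap S x0 y0 is js μ ys k ≤ S.c * E0sq P S x0 y0 xs ys :=
  (mul_le_mul_of_nonneg_left (meanLagGap_le_meanAugLagGap hS hsamp ys k)
    (hS.add_c_sub_one_pos k).le).trans (mul_meanAugLagGap_le hP hS hβ hc hg hx0 hsamp hxs hys k)

theorem mul_sq_meanRes_le (hP : P.Assumption S.L) (hS : S.Admissible)
    (hβ : 0 < S.Lhσ ∨ 0 < S.Lbar P) (hg : LipschitzExt M P.gSum)
    (hx0 : x0 ∈ P.dom) (hsamp : Sampling S μ is js)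
    (hys : P.IsMultiplier ys) (k : ℕ) :
    (k + S.c - 1) * meanRes S x0 y0 is js μ k ^ 2
      ≤ 2 * S.c / S.ρ₀ * meanAugLagGap S x0 y0 is js μ ys k := by
  have hτ₀ := hS.τ₀_pos
  have hρ₀ := hS.ρ₀_pos
  have hc := hS.c_pos
  have hgap := meanLagGap_nonneg (y0 := y0) (is := is) (js := js) (μ := μ) hP hS hβ hg hx0 hys k
  have hpen := meanLagGap_add_mul_sq_meanRes_le (x0 := x0) (y0 := y0) hS hsamp ys k
  calc (k + S.c - 1) * meanRes S x0 y0 is js μ k ^ 2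
      = 2 * S.c / S.ρ₀ * (S.weight k * (S.ρ₀ * S.τ₀ / 2) * meanRes S x0 y0 is js μ k ^ 2) := by
        rw [Params.weight]; field_simp
    _ ≤ 2 * S.c / S.ρ₀ * meanAugLagGap S x0 y0 is js μ ys k :=
        mul_le_mul_of_nonneg_left (by linarith) (by positivity)

theorem mul_meanRes_le (hP : P.Assumption S.L) (hS : S.Admissible)
    (hβ : 0 < S.Lhσ ∨ 0 < S.Lbar P) (hc : 1 < S.c * S.τ₀) (hg : LipschitzExt M P.gSum)
    (hx0 : x0 ∈ P.dom) (hsamp : Sampling S μ is js) (hxs : xs ∈ P.primalSolutions)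
    (hys : P.IsMultiplier ys) (k : ℕ) :
    (k + S.c - 1) * meanRes S x0 y0 is js μ k
      ≤ √(E0sq P S x0 y0 xs ys) * S.c * √(2 * S.c / S.ρ₀) := by
  have hk := (hS.add_c_sub_one_pos k).le
  have hρ₀ := hS.ρ₀_pos
  have hc0 := hS.c_pos
  have hgap := mul_meanAugLagGap_le (y0 := y0) hP hS hβ hc hg hx0 hsamp hxs hys k
  have hE : 0 ≤ E0sq P S x0 y0 xs ys := nonneg_of_mul_nonneg_right
    ((mul_nonneg hk (meanAugLagGap_nonneg hP hS hβ hg hx0 hsamp hys k)).trans hgap) hc0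
  refine le_of_abs_le (abs_le_of_sq_le_sq ?_ (by positivity))
  calc ((k + S.c - 1) * meanRes S x0 y0 is js μ k) ^ 2
      = (k + S.c - 1) * ((k + S.c - 1) * meanRes S x0 y0 is js μ k ^ 2) := by ring
    _ ≤ (k + S.c - 1) * (2 * S.c / S.ρ₀ * meanAugLagGap S x0 y0 is js μ ys k) :=
        mul_le_mul_of_nonneg_left (mul_sq_meanRes_le hP hS hβ hg hx0 hsamp hys k) hk
    _ = 2 * S.c / S.ρ₀ * ((k + S.c - 1) * meanAugLagGap S x0 y0 is js μ ys k) := by ring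
    _ ≤ 2 * S.c / S.ρ₀ * (S.c * E0sq P S x0 y0 xs ys) :=
        mul_le_mul_of_nonneg_left hgap (by positivity)
    _ ≤ 2 * S.c / S.ρ₀ * (S.c * E0sq P S x0 y0 xs ys) * S.c :=
        le_mul_of_one_le_right (by positivity) hS.one_lt_c.le
    _ = (√(E0sq P S x0 y0 xs ys) * S.c * √(2 * S.c / S.ρ₀)) ^ 2 := by
        rw [mul_pow, mul_pow, Real.sq_sqrt hE, Real.sq_sqrt (by positivity)]
        ring

theorem integral_F_sub_le_div (hP : P.Assumption S.L) (hS : S.Admissible)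
    (hβ : 0 < S.Lhσ ∨ 0 < S.Lbar P) (hc : 1 < S.c * S.τ₀) (hg : LipschitzExt M P.gSum)
    (hx0 : x0 ∈ P.dom) (hsamp : Sampling S μ is js) (hxs : xs ∈ P.primalSolutions)
    (hys : P.IsMultiplier ys) (k : ℕ) :
    ∫ ω, ((P.F (trajectory S x0 y0 is js k ω).x).toReal - P.Fstar.toReal) ∂μ
      ≤ (S.c * E0sq P S x0 y0 xs ys
          + (M + ‖ys‖) * √(E0sq P S x0 y0 xs ys) * S.c * √(2 * S.c / S.ρ₀)) / (k + S.c - 1) := by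
  have hk := hS.add_c_sub_one_pos k
  have hgap := mul_meanLagGap_le (y0 := y0) hP hS hβ hc hg hx0 hsamp hxs hys k
  have hres := mul_le_mul_of_nonneg_left
    (mul_meanRes_le (y0 := y0) hP hS hβ hc hg hx0 hsamp hxs hys k)
    (add_nonneg M.coe_nonneg (norm_nonneg ys))
  rw [le_div_iff₀ hk]
  refine (mul_le_mul_of_nonneg_right
    (integral_F_sub_le hP hS hβ hg hx0 hsamp ys k) hk.le).trans ?_
  linarith

theorem summable_meanAugLagGap (hP : P.Assumption S.L) (hS : S.Admissible)
    (hβ : 0 < S.Lhσ ∨ 0 < S.Lbar P) (hc : 1 < S.c * S.τ₀) (hg : LipschitzExt M P.gSum)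
    (hx0 : x0 ∈ P.dom) (hsamp : Sampling S μ is js) (hys : P.IsMultiplier ys) :
    Summable (meanAugLagGap S x0 y0 is js μ ys) := by
  obtain ⟨xs, hxs⟩ := hP.solution
  have hgap := meanAugLagGap_nonneg (y0 := y0) hP hS hβ hg hx0 hsamp hys
  have hdecay := Params.decay_pos hc
  exact (summable_mul_left_iff hdecay.ne').1 (summable_of_add_le
    (fun k => (mul_nonneg (hS.weight_pos k).le (hgap k)).trans
      (weight_mul_meanAugLagGap_le_integral_lyapunov (xs := xs) hS hP.L_nonneg hsamp k))
    (fun k => mul_nonneg hdecay.le (hgap k))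
    (integral_lyapunov_succ_add_le hP hS hβ hc hg hx0 hsamp hxs ys))

theorem liminf_mul_integral_F_sub_eq_zero (hP : P.Assumption S.L) (hS : S.Admissible)
    (hβ : 0 < S.Lhσ ∨ 0 < S.Lbar P) (hc : 1 < S.c * S.τ₀) (hg : LipschitzExt M P.gSum)
    (hx0 : x0 ∈ P.dom) (hsamp : Sampling S μ is js) :
    liminf (fun k : ℕ => ((k * √(Real.log k) * ∫ ω, ((P.F (trajectory S x0 y0 is js k ω).x).toReal
      - P.Fstar.toReal) ∂μ : ℝ) : EReal)) atTop = 0 := by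
  obtain ⟨xs, hxs⟩ := hP.solution
  obtain ⟨ys, hys⟩ := hP.exists_isMultiplier hg
  have hk (k : ℕ) : (k : ℝ) ≤ k + S.c - 1 := by linarith [hS.one_lt_c]
  have hgap0 := meanLagGap_nonneg (y0 := y0) (is := is) (js := js) (μ := μ) hP hS hβ hg hx0 hys
  have hsum := summable_meanAugLagGap (y0 := y0) hP hS hβ hc hg hx0 hsamp hys
  have hgap : Summable (meanLagGap S x0 y0 is js μ ys) :=
    hsum.of_nonneg_of_le hgap0 (meanLagGap_le_meanAugLagGap hS hsamp ys)
  have hres : Summable fun k : ℕ => k * meanRes S x0 y0 is js μ k ^ 2 :=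
    (hsum.mul_left (2 * S.c / S.ρ₀)).of_nonneg_of_le (fun k => by positivity) fun k =>
      (mul_le_mul_of_nonneg_right (hk k) (sq_nonneg _)).trans
        (mul_sq_meanRes_le hP hS hβ hg hx0 hsamp hys k)
  refine liminf_coe_eq_zero (fun k => mul_nonneg (by positivity)
    (integral_F_sub_nonneg hP hS hβ hg hx0 k)) fun ε hε => ?_
  have hfreq := frequently_mul_sqrt_log_lt (b := fun k => (M + ‖ys‖) * meanRes S x0 y0 is js μ k)
    hgap0 hgap (fun k => (mul_le_mul_of_nonneg_right (hk k) (hgap0 k)).trans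
      (mul_meanLagGap_le hP hS hβ hc hg hx0 hsamp hxs hys k))
    ((hres.mul_left ((M + ‖ys‖) ^ 2)).congr fun k => by ring) hε
  exact hfreq.mono fun k hlt => (mul_le_mul_of_nonneg_left
    (integral_F_sub_le hP hS hβ hg hx0 hsamp ys k) (by positivity)).trans_lt hlt

end Mean

end RandomizedPD

end

theorem theorem3p2 {n m : ℕ} (P : RandomizedPD.Problem n m) (S : RandomizedPD.Params n m)
    (hP : P.Assumption S.L) (hS : S.Admissible)
    -- the step size `β_k` is well defined
    (hβ : 0 < S.Lhσ ∨ 0 < S.Lbar P)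
    (hc : 1 < S.c * S.τ₀)
    (M : ℝ≥0) (hg : RandomizedPD.LipschitzExt M P.gSum)
    (x0 : RandomizedPD.BlockSpace P.p) (y0 : RandomizedPD.BlockSpace P.d) (hx0 : P.F x0 < ⊤)
    {Ω : Type*} [MeasurableSpace Ω] (μ : Measure Ω) [IsProbabilityMeasure μ]
    (is : ℕ → Ω → Fin m) (js : ℕ → Ω → Fin n) (hsamp : RandomizedPD.Sampling S μ is js)
    (x : ℕ → Ω → RandomizedPD.BlockSpace P.p)
    (hx : ∀ k ω, x k ω =
      (RandomizedPD.iterate P S x0 y0 (fun l => is l ω) (fun l => js l ω) k).x) :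
    -- the expectations below are expectations of finite, integrable random variables
    (∀ k, (∀ᵐ ω ∂μ, P.F (x k ω) < ⊤) ∧ Integrable (fun ω => (P.F (x k ω)).toReal) μ) ∧
    (∀ xs ∈ P.primalSolutions, ∀ ys ∈ P.dualSolutions, ∀ k : ℕ,
      ∫ ω, ((P.F (x k ω)).toReal - P.Fstar.toReal) ∂μ ≤
        (S.c * RandomizedPD.E0sq P S x0 y0 xs ys
          + (M + ‖ys‖) * √(RandomizedPD.E0sq P S x0 y0 xs ys) * S.c * √(2 * S.c / S.ρ₀))
          / (k + S.c - 1)) ∧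
    liminf (fun k : ℕ => ((k * √(Real.log k)
      * ∫ ω, ((P.F (x k ω)).toReal - P.Fstar.toReal) ∂μ : ℝ) : EReal)) atTop = 0 ∧
    RandomizedPD.SmallOLiminf
      (fun k => (∫ ω, (P.F (x k ω)).toReal ∂μ) - P.Fstar.toReal)
      (fun k => 1 / (k * √(Real.log k))) := by
  obtain rfl : x = fun k ω => (RandomizedPD.trajectory S x0 y0 is js k ω).x := by
    funext k ω
    rw [hx, ← RandomizedPD.trajectory_toState]
  replace hx0 := (hP.F_lt_top_iff hg).1 hx0
  have hdom (k ω) := (RandomizedPD.isFeasible_trajectory y0 is js hP hS hβ hg hx0 k ω).x_mem_dom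
  have hint (k) := RandomizedPD.integrable_trajectory (x0 := x0) (y0 := y0) hsamp k
    fun a => (P.F a.x).toReal
  have hliminf := RandomizedPD.liminf_mul_integral_F_sub_eq_zero (y0 := y0)
    hP hS hβ hc hg hx0 hsamp
  refine ⟨fun k => ⟨.of_forall fun ω => (hP.F_lt_top_iff hg).2 (hdom k ω), hint k⟩,
    fun xs hxs ys hys k => RandomizedPD.integral_F_sub_le_div hP hS hβ hc hg hx0 hsamp hxs
      (hP.isMultiplier_of_dualSolutions hg hys) k, hliminf, ?_⟩
  rw [RandomizedPD.SmallOLiminf, ← hliminf]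
  congr 1
  funext k
  rw [integral_sub (hint k) (integrable_const _), integral_const, probReal_univ, one_smul,
    div_div_eq_mul_div, div_one, mul_comm]
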